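/- Let $(X,d)$ be a metric space equipped with a Borel regular outer measure $\mu$ such that every ball $B(x,r)=\{y\in X: d(y,x)<r\}$ ($x\in X$, $r>0$) has positive finite measure, and such that $\mu$ is doubling: there is a constant $c_d>0$ with $\mu(B(x,2r))\le c_d\,\mu(B(x,r))$ for all $x\in X$ and $r>0$. Let $L^0(X)$ be the set of measurable, almost everywhere finite functions $u\colon X\to[-\infty,\infty]$. A sequence $(g_k)_{k\in\mathbb Z}$ of measurable functions $g_k\colon X\to[0,\infty]$ is a fractional $s$-gradient of $u\in L^0(X)$ if there is a set $E\subset X$ with $\mu(E)=0$ such that $$|u(x)-u(y)|\le d(x,y)^s\,(g_k(x)+g_k(y))$$ for all $k\in\mathbb Z$ and all $x,y\in X\setminus E$ with $2^{-k-1}\le d(x,y)<2^{-k}$. Let $\mathbb D^s(u)$ be the set of all fractional $s$-gradients of $u$. For $s>0$ and $0<p,q<\infty$ put $$\|u\|_{\dot N^s_{p,q}(X)}=\inf_{(g_k)\in\mathbb D^s(u)}\Big(\sum_{k\in\mathbb Z}\|g_k\|_{L^p(X)}^q\Big)^{1/q},\qquad \|u\|_{N^s_{p,q}(X)}=\|u\|_{L^p(X)}+\|u\|_{\dot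 N^s_{p,q}(X)},$$ and let $N^s_{p,q}(X)$ be the set of all $u\in L^0(X)$ with $\|u\|_{N^s_{p,q}(X)}<\infty$. The Besov capacity of a set $E\subset X$ is $$C^s_{p,q}(E)=\inf\big\{\|u\|_{N^s_{p,q}(X)}^p : u\in N^s_{p,q}(X),\ u\ge 1 \text{ in a neighbourhood of } E\big\}$$ (with $\inf\emptyset=\infty$). A function $v\colon X\to[-\infty,\infty]$ is $C^s_{p,q}$-quasicontinuous if for every $\varepsilon>0$ there is a set $U\subset X$ such that $C^s_{p,q}(U)<\varepsilon$ and the restriction of $v$ to $X\setminus U$ is continuous. **Theorem.** Let $0<s<1$ and $0<p,q<\infty$. Then for every $u\in N^s_{p,q}(X)$ there is a $C^s_{p,q}$-quasicontinuous function $v\colon X\to[-\infty,\infty]$ such that $u=v$ almost everywhere. -/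

import Mathlib

open MeasureTheory
open scoped ENNReal NNReal

/-- A Borel measure on a metric space is doubling: there is a constant `c` with
`μ (B(x, 2r)) ≤ c μ (B(x, r))` for all open balls, and every ball has positive finite measure.
(A Borel regular outer measure on a metric space is the same thing as the extension to all sets of
a Borel measure, and this extension is what Mathlib's `μ E` denotes for an arbitrary set `E`.) -/
structure IsDoublingMeasure {X : Type*} [MetricSpace X] [MeasurableSpace X]
    (μ : Measure X) : Prop where
  doubling : ∃ c : ℝ≥0, ∀ (x : X) (r : ℝ), 0 < r →
    μ (Metric.ball x (2 * r)) ≤ c * μ (Metric.ball x r)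
  ball_pos : ∀ (x : X) (r : ℝ), 0 < r → 0 < μ (Metric.ball x r)
  ball_lt_top : ∀ (x : X) (r : ℝ), 0 < r → μ (Metric.ball x r) < ∞

/-- The class `L⁰(X)` of measurable, almost everywhere finite functions `u : X → [-∞, ∞]`.
Measurability is with respect to the completion of `μ`, as for a Borel regular outer measure. -/
def MemL0 {X : Type*} [MeasurableSpace X] (μ : Measure X) (u : X → EReal) : Prop :=
  AEMeasurable u μ ∧ ∀ᵐ x ∂μ, u x ≠ ⊤ ∧ u x ≠ ⊥

/-- `(g k)` is a fractional `s`-gradient of `u`: the `g k` are nonnegative and measurable, and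
outside a set `E` of measure zero,
`|u x - u y| ≤ d(x, y) ^ s * (g k x + g k y)` whenever `2 ^ (-k - 1) ≤ d(x, y) < 2 ^ (-k)`.
(Here `|∞ - ∞| = ∞`; since `u` is finite almost everywhere, the convention is immaterial.) -/
def IsFracGradient {X : Type*} [MetricSpace X] [MeasurableSpace X] (μ : Measure X)
    (s : ℝ) (u : X → EReal) (g : ℤ → X → ℝ≥0∞) : Prop :=
  (∀ k, AEMeasurable (g k) μ) ∧
    ∃ E : Set X, μ E = 0 ∧ ∀ (k : ℤ) (x y : X), x ∉ E → y ∉ E →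
      (2 : ℝ) ^ (-k - 1) ≤ dist x y → dist x y < (2 : ℝ) ^ (-k) →
        (u x - u y).abs ≤ ENNReal.ofReal (dist x y ^ s) * (g k x + g k y)

/-- The `l^q(L^p(X))`-norm `(∑ₖ ‖g k‖_p ^ q) ^ (1 / q)` of a sequence of nonnegative functions,
for `0 < p, q < ∞`. -/
noncomputable def mixedNorm {X : Type*} [MeasurableSpace X] (μ : Measure X)
    (p q : ℝ) (g : ℤ → X → ℝ≥0∞) : ℝ≥0∞ :=
  (∑' k : ℤ, eLpNorm (g k) (ENNReal.ofReal p) μ ^ q) ^ (1 / q)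

/-- The homogeneous Hajłasz–Besov seminorm: the infimum of the `l^q(L^p(X))`-norms of the
fractional `s`-gradients of `u`. -/
noncomputable def besovSeminorm {X : Type*} [MetricSpace X] [MeasurableSpace X] (μ : Measure X)
    (s p q : ℝ) (u : X → EReal) : ℝ≥0∞ :=
  ⨅ (g : ℤ → X → ℝ≥0∞) (_ : IsFracGradient μ s u g), mixedNorm μ p q g

/-- The Hajłasz–Besov norm: the `L^p`-norm plus the homogeneous seminorm. -/
noncomputable def besovNorm {X : Type*} [MetricSpace X] [MeasurableSpace X] (μ : Measure X)
    (s p q : ℝ) (u : X → EReal) : ℝ≥0∞ :=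
  eLpNorm (fun x => (u x).abs) (ENNReal.ofReal p) μ + besovSeminorm μ s p q u

/-- The Hajłasz–Besov space `N^s_{p,q}(X)`: the functions in `L⁰(X)` whose `L^p`-norm and
homogeneous Hajłasz–Besov seminorm are finite. -/
def besovSpace {X : Type*} [MetricSpace X] [MeasurableSpace X] (μ : Measure X)
    (s p q : ℝ) : Set (X → EReal) :=
  {u | MemL0 μ u ∧ eLpNorm (fun x => (u x).abs) (ENNReal.ofReal p) μ < ∞ ∧
    besovSeminorm μ s p q u < ∞}

/-- The admissible functions for the capacity of `E`: the Hajłasz–Besov functions that are at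
least `1` at every point of some neighbourhood of `E`. -/
def besovAdmissible {X : Type*} [MetricSpace X] [MeasurableSpace X] (μ : Measure X)
    (s p q : ℝ) (E : Set X) : Set (X → EReal) :=
  {u | u ∈ besovSpace μ s p q ∧ ∃ V : Set X, IsOpen V ∧ E ⊆ V ∧ ∀ x ∈ V, 1 ≤ u x}

/-- The Besov capacity `C^s_{p,q}(E)` (it is `∞` if no function is admissible). -/
noncomputable def besovCapacity {X : Type*} [MetricSpace X] [MeasurableSpace X] (μ : Measure X)
    (s p q : ℝ) (E : Set X) : ℝ≥0∞ :=
  ⨅ u ∈ besovAdmissible μ s p q E, besovNorm μ s p q u ^ p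

/-- `C^s_{p,q}`-quasicontinuity of a function `v : X → [-∞, ∞]`. -/
def BesovQuasicontinuous {X : Type*} [MetricSpace X] [MeasurableSpace X] (μ : Measure X)
    (s p q : ℝ) (v : X → EReal) : Prop :=
  ∀ ε : ℝ, 0 < ε → ∃ U : Set X,
    besovCapacity μ s p q U < ENNReal.ofReal ε ∧ ContinuousOn v Uᶜ

/-! Continuous functions approximate `u` in the Besov norm, and a rapidly converging sequence of
them converges uniformly off open sets of small capacity.

Approximation at scale `r` averages point values of `f = u.toReal` over an `r`-separated net with
Lipschitz weights. The sample point near each net point is chosen so that the gradient majorant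
there is at most its `p`-mean; this replaces integral means of `f`, which need not exist for small
`p`. The error and the local Lipschitz constants are then controlled in `L^p`
(`exists_continuous_approx`). At scales coarser than `r` the error bound yields a fractional
gradient of `f - v`. At finer scales the Lipschitz bound for `v` supplements the gradient of `f`,
and `s < 1` makes its contribution decay geometrically. Only the tail of `(g k)` enters, so the
norms tend to zero (`exists_continuous_approx_tail`).

For a rapid sequence `v i`, the function `tailOscillation v j` is lower semicontinuous and is itself
a test function for the open set where it exceeds `1`, so `besovCapacity_le` makes the capacity of
that set small. Off this set `v i` converges uniformly
(`continuousOn_limUnder_of_tailOscillation_le_one`). One supremum handles the whole tail, so neither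
subadditivity of the capacity nor a triangle inequality for the norm is needed, and all `p, q > 0`
are treated alike. -/

/-! ### Separated nets in doubling spaces -/

theorem exists_separated_net {X : Type*} [MetricSpace X] {r : ℝ} (hr : 0 < r) :
    ∃ N : Set X, N.Pairwise (fun x y => r ≤ dist x y) ∧ ∀ x, ∃ z ∈ N, dist x z < r := by
  obtain ⟨N, hN⟩ := zorn_subset {N : Set X | N.Pairwise (fun x y => r ≤ dist x y)} (by
    intro c hc hchain
    refine ⟨⋃₀ c, ?_, fun s hs => Set.subset_sUnion_of_mem hs⟩
    exact (Set.pairwise_sUnion hchain.directedOn).2 fun s hs => hc hs)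
  refine ⟨N, hN.prop, fun x => ?_⟩
  by_contra! h
  have hx : x ∉ N := fun hx => by
    have := h x hx
    rw [dist_self] at this
    linarith
  have : (insert x N).Pairwise (fun x y => r ≤ dist x y) := by
    refine hN.prop.insert fun z hz _ => ⟨h z hz, ?_⟩
    rw [dist_comm]
    exact h z hz
  exact hx (hN.le_of_ge this (Set.subset_insert x N) (Set.mem_insert x N))

namespace IsDoublingMeasure

variable {X : Type*} [MetricSpace X] [MeasurableSpace X] {μ : Measure X}

theorem measure_ball_two_pow_mul_le {c : ℝ≥0}
    (hc : ∀ (x : X) (r : ℝ), 0 < r → μ (Metric.ball x (2 * r)) ≤ c * μ (Metric.ball x r))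
    (m : ℕ) (x : X) {r : ℝ} (hr : 0 < r) :
    μ (Metric.ball x (2 ^ m * r)) ≤ (c : ℝ≥0∞) ^ m * μ (Metric.ball x r) := by
  induction m with
  | zero => simp
  | succ m ih =>
    calc μ (Metric.ball x (2 ^ (m + 1) * r)) = μ (Metric.ball x (2 * (2 ^ m * r))) := by
          congr 2; ring
      _ ≤ c * μ (Metric.ball x (2 ^ m * r)) := hc x _ (by positivity)
      _ ≤ c * ((c : ℝ≥0∞) ^ m * μ (Metric.ball x r)) := by gcongr
      _ = (c : ℝ≥0∞) ^ (m + 1) * μ (Metric.ball x r) := by ring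

theorem sigmaFinite [BorelSpace X] (hμ : IsDoublingMeasure μ) : SigmaFinite μ := by
  rcases isEmpty_or_nonempty X with hX | ⟨⟨a⟩⟩
  · have : μ = 0 := Measure.eq_zero_of_isEmpty μ
    rw [this]
    infer_instance
  · refine ⟨⟨⟨fun n => Metric.ball a (n + 1), fun _ => trivial,
      fun n => hμ.ball_lt_top a _ (by positivity), ?_⟩⟩⟩
    refine Set.eq_univ_of_forall fun x => ?_
    obtain ⟨n, hn⟩ := exists_nat_gt (dist x a)
    exact Set.mem_iUnion.2 ⟨n, by rw [Metric.mem_ball]; linarith⟩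

omit [MeasurableSpace X] in
theorem pairwise_disjoint_ball {N : Set X} {r : ℝ}
    (hN : N.Pairwise (fun x y => r ≤ dist x y)) :
    Pairwise (Function.onFun Disjoint fun z : N => Metric.ball (z : X) (r / 2)) := by
  intro z w hzw
  refine Metric.ball_disjoint_ball ?_
  have := hN z.2 w.2 (fun h => hzw (Subtype.ext h))
  linarith

theorem countable_net [BorelSpace X] (hμ : IsDoublingMeasure μ) {N : Set X} {r : ℝ} (hr : 0 < r)
    (hN : N.Pairwise (fun x y => r ≤ dist x y)) : Countable N := by
  have := hμ.sigmaFinite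
  have h := Measure.countable_meas_pos_of_disjoint_iUnion (μ := μ)
    (As := fun z : N => Metric.ball (z : X) (r / 2)) (fun _ => Metric.isOpen_ball.measurableSet)
    (pairwise_disjoint_ball hN)
  have h' : {z : N | 0 < μ (Metric.ball (z : X) (r / 2))} = Set.univ :=
    Set.eq_univ_of_forall fun z => hμ.ball_pos _ _ (by positivity)
  rw [h'] at h
  exact Set.countable_univ_iff.1 h

/-- Volume counting: the balls `B(z, r / 2)` are disjoint and lie in `B(x, 5r)`, while `B(x, 5r) ⊆
B(z, 16r)`, so five doublings compare their measures. The bound depends on neither `x` nor `r`. -/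
theorem card_net_le [BorelSpace X] (hμ : IsDoublingMeasure μ) {c : ℝ≥0}
    (hc : ∀ (x : X) (r : ℝ), 0 < r → μ (Metric.ball x (2 * r)) ≤ c * μ (Metric.ball x r))
    {N : Set X} {r : ℝ} (hr : 0 < r) (hN : N.Pairwise (fun x y => r ≤ dist x y)) (x : X)
    (S : Finset N) (hS : ∀ z ∈ S, dist x z < 4 * r) : (S.card : ℝ) ≤ (c : ℝ) ^ 5 := by
  have hsum : ∑ z ∈ S, μ (Metric.ball (z : X) (r / 2)) ≤ μ (Metric.ball x (5 * r)) := by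
    rw [← measure_biUnion_finset (fun z _ w _ h => pairwise_disjoint_ball hN h)
      (fun _ _ => Metric.isOpen_ball.measurableSet)]
    refine measure_mono (Set.iUnion₂_subset fun z hz => Metric.ball_subset_ball' ?_)
    have := hS z hz
    rw [dist_comm] at this
    linarith
  have hlow : ∀ z ∈ S, μ (Metric.ball x (5 * r)) ≤
      (c : ℝ≥0∞) ^ 5 * μ (Metric.ball (z : X) (r / 2)) := by
    intro z hz
    refine le_trans (measure_mono (Metric.ball_subset_ball' ?_))
      (measure_ball_two_pow_mul_le hc 5 z (by positivity))
    have := hS z hz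
    linarith
  have hpos := hμ.ball_pos x (5 * r) (by positivity)
  have hfin := hμ.ball_lt_top x (5 * r) (by positivity)
  have h : (S.card : ℝ≥0∞) * μ (Metric.ball x (5 * r)) ≤
      (c : ℝ≥0∞) ^ 5 * μ (Metric.ball x (5 * r)) := by
    calc (S.card : ℝ≥0∞) * μ (Metric.ball x (5 * r))
        = ∑ z ∈ S, μ (Metric.ball x (5 * r)) := by simp
      _ ≤ ∑ z ∈ S, (c : ℝ≥0∞) ^ 5 * μ (Metric.ball (z : X) (r / 2)) := Finset.sum_le_sum hlow
      _ = (c : ℝ≥0∞) ^ 5 * ∑ z ∈ S, μ (Metric.ball (z : X) (r / 2)) := by rw [Finset.mul_sum]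
      _ ≤ _ := by gcongr
  have h2 : (S.card : ℝ≥0∞) ≤ (c : ℝ≥0∞) ^ 5 :=
    (ENNReal.mul_le_mul_iff_left hpos.ne' hfin.ne).1 h
  have h3 : (S.card : ℝ≥0) ≤ c ^ 5 := by exact_mod_cast h2
  exact_mod_cast h3

theorem finite_net [BorelSpace X] (hμ : IsDoublingMeasure μ)
    {N : Set X} {r : ℝ} (hr : 0 < r) (hN : N.Pairwise (fun x y => r ≤ dist x y)) (x : X) :
    {z : N | dist x z < 4 * r}.Finite := by
  obtain ⟨c, hc⟩ := hμ.doubling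
  by_contra hinf
  obtain ⟨n, hn⟩ := exists_nat_gt ((c : ℝ) ^ 5)
  obtain ⟨S, hS, hcard⟩ := Set.Infinite.exists_subset_card_eq hinf n
  have := hμ.card_net_le hc hr hN x S fun z hz => hS hz
  rw [hcard] at this
  linarith

end IsDoublingMeasure

/-! ### Lipschitz weights and weighted means over a net -/

/-- The function `z ↦ max (0, 2 - d(x, z) / r)`, a Lipschitz bump around `z`. -/
noncomputable def netBump {X : Type*} [MetricSpace X] (r : ℝ) (z x : X) : ℝ :=
  max 0 (2 - dist x z / r)

section Bump

variable {X : Type*} [MetricSpace X] {r : ℝ}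

theorem netBump_nonneg (z x : X) : 0 ≤ netBump r z x := le_max_left _ _

theorem one_le_netBump (hr : 0 < r) {z x : X} (h : dist x z < r) : 1 ≤ netBump r z x := by
  refine le_max_of_le_right ?_
  have : dist x z / r ≤ 1 := (div_le_one hr).2 h.le
  linarith

theorem netBump_eq_zero (hr : 0 < r) {z x : X} (h : 2 * r ≤ dist x z) : netBump r z x = 0 := by
  refine max_eq_left ?_
  have : 2 ≤ dist x z / r := (le_div_iff₀ hr).2 h
  linarith

theorem abs_netBump_sub_le (hr : 0 < r) (z x y : X) :
    |netBump r z x - netBump r z y| ≤ dist x y / r := by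
  refine (abs_max_sub_max_le_max _ _ _ _).trans (max_le (by simp; positivity) ?_)
  have : (2 - dist x z / r) - (2 - dist y z / r) = (dist y z - dist x z) / r := by ring
  rw [this, abs_div, abs_of_pos hr, dist_comm x y]
  gcongr
  exact abs_dist_sub_le y x z

theorem continuous_netBump (z : X) : Continuous (netBump r z) := by
  unfold netBump
  fun_prop

/-- The weighted mean of the values `a z` with weights `netBump r (z : X) x`. -/
noncomputable def netMean (N : Set X) (r : ℝ) (a : N → ℝ) (x : X) : ℝ :=
  (∑' z : N, netBump r (z : X) x * a z) / ∑' z : N, netBump r (z : X) x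

theorem netMean_eq {N : Set X} (hr : 0 < r) (a : N → ℝ) {x : X} (S : Finset N)
    (hS : ∀ z : N, dist x z < 2 * r → z ∈ S) :
    netMean N r a x = (∑ z ∈ S, netBump r (z : X) x * a z) / ∑ z ∈ S, netBump r (z : X) x := by
  have h0 : ∀ z : N, z ∉ S → netBump r (z : X) x = 0 := fun z hz =>
    netBump_eq_zero hr (not_lt.1 fun h => hz (hS z h))
  rw [netMean, tsum_eq_sum (s := S) (fun z hz => by rw [h0 z hz, zero_mul]),
    tsum_eq_sum (s := S) h0]

theorem netMean_sub {N : Set X} (hr : 0 < r) (a : N → ℝ) (c : ℝ) {x : X} (S : Finset N)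
    (hS : ∀ z : N, dist x z < 2 * r → z ∈ S) (hP : 0 < ∑ z ∈ S, netBump r (z : X) x) :
    netMean N r a x - c =
      (∑ z ∈ S, netBump r (z : X) x * (a z - c)) / ∑ z ∈ S, netBump r (z : X) x := by
  rw [netMean_eq hr a S hS, eq_div_iff hP.ne', sub_mul, div_mul_cancel₀ _ hP.ne', Finset.mul_sum,
    ← Finset.sum_sub_distrib]
  exact Finset.sum_congr rfl fun z _ => by ring

theorem abs_sum_netBump_mul_le {N : Set X} (b : N → ℝ) {x : X} (S : Finset N) {M : ℝ}
    (hb : ∀ z ∈ S, |b z| ≤ M) :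
    |∑ z ∈ S, netBump r (z : X) x * b z| ≤ M * ∑ z ∈ S, netBump r (z : X) x := by
  refine (Finset.abs_sum_le_sum_abs _ _).trans ?_
  rw [Finset.mul_sum]
  refine Finset.sum_le_sum fun z hz => ?_
  rw [abs_mul, abs_of_nonneg (netBump_nonneg _ _), mul_comm]
  exact mul_le_mul_of_nonneg_right (hb z hz) (netBump_nonneg _ _)

theorem one_le_sum_netBump {N : Set X} (hr : 0 < r) (hcov : ∀ x : X, ∃ z ∈ N, dist x z < r) {x : X}
    (S : Finset N) (hS : ∀ z : N, dist x z < 2 * r → z ∈ S) :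
    1 ≤ ∑ z ∈ S, netBump r (z : X) x := by
  obtain ⟨z, hz, hxz⟩ := hcov x
  exact (one_le_netBump hr hxz).trans (Finset.single_le_sum (f := fun z : N => netBump r (z : X) x)
    (fun w _ => netBump_nonneg _ _) (hS ⟨z, hz⟩ (by simp only; linarith)))

theorem abs_netMean_sub_le {N : Set X} (hr : 0 < r) (hcov : ∀ x : X, ∃ z ∈ N, dist x z < r)
    (a : N → ℝ) (c : ℝ) {x : X} (S : Finset N) (hS : ∀ z : N, dist x z < 2 * r → z ∈ S) {M : ℝ}
    (hb : ∀ z ∈ S, |a z - c| ≤ M) : |netMean N r a x - c| ≤ M := by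
  have hP := one_le_sum_netBump hr hcov S hS
  rw [netMean_sub hr a c S hS (by linarith), abs_div, abs_of_pos (one_pos.trans_le hP),
    div_le_iff₀ (by linarith)]
  exact abs_sum_netBump_mul_le _ S hb

/-- After subtracting `c`, the means are quotients `Ax / Px` and `Ay / Py` over one common finite
set. Numerators and denominators vary by at most `S.card` times the Lipschitz bound of a bump, and
the covering property keeps the denominators at least `1`. -/
theorem abs_netMean_sub_netMean_le {N : Set X} (hr : 0 < r)
    (hcov : ∀ x : X, ∃ z ∈ N, dist x z < r)
    (a : N → ℝ) (c : ℝ) {x y : X} (S : Finset N) (hx : ∀ z : N, dist x z < 2 * r → z ∈ S)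
    (hy : ∀ z : N, dist y z < 2 * r → z ∈ S) {M : ℝ} (hM : 0 ≤ M)
    (hb : ∀ z ∈ S, |a z - c| ≤ M) :
    |netMean N r a x - netMean N r a y| ≤ 2 * S.card * (dist x y / r) * M := by
  have hPx := one_le_sum_netBump hr hcov S hx
  have hPy := one_le_sum_netBump hr hcov S hy
  have hAy := abs_sum_netBump_mul_le (r := r) (x := y) (fun z => a z - c) S hb
  have hmx := netMean_sub hr a c S hx (by linarith)
  have hmy := netMean_sub hr a c S hy (by linarith)
  have hA : |∑ z ∈ S, netBump r (z : X) x * (a z - c) - ∑ z ∈ S, netBump r (z : X) y * (a z - c)| ≤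
      S.card * (dist x y / r) * M := by
    rw [← Finset.sum_sub_distrib]
    refine (Finset.abs_sum_le_sum_abs _ _).trans ?_
    rw [mul_assoc, ← nsmul_eq_mul]
    refine Finset.sum_le_card_nsmul _ _ _ fun z hz => ?_
    rw [← sub_mul, abs_mul]
    exact mul_le_mul (abs_netBump_sub_le hr (z : X) x y) (hb z hz) (abs_nonneg _) (by positivity)
  have hP : |∑ z ∈ S, netBump r (z : X) y - ∑ z ∈ S, netBump r (z : X) x| ≤ S.card * (dist x y / r) := by
    rw [← Finset.sum_sub_distrib]
    refine (Finset.abs_sum_le_sum_abs _ _).trans ?_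
    rw [← nsmul_eq_mul]
    refine Finset.sum_le_card_nsmul _ _ _ fun z hz => ?_
    rw [abs_sub_comm]
    exact abs_netBump_sub_le hr (z : X) x y
  generalize ∑ z ∈ S, netBump r (z : X) x * (a z - c) = Ax at *
  generalize ∑ z ∈ S, netBump r (z : X) y * (a z - c) = Ay at *
  generalize ∑ z ∈ S, netBump r (z : X) x = Px at *
  generalize ∑ z ∈ S, netBump r (z : X) y = Py at *
  have hPx0 : 0 < Px := by linarith
  have hPy0 : 0 < Py := by linarith
  set K : ℝ := S.card * (dist x y / r) with hK
  have hK0 : 0 ≤ K := by positivity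
  have key : netMean N r a x - netMean N r a y = ((Ax - Ay) + Ay / Py * (Py - Px)) / Px := by
    have : netMean N r a x - netMean N r a y = Ax / Px - Ay / Py := by rw [← hmx, ← hmy]; ring
    rw [this]
    field_simp
    ring
  rw [key, abs_div, abs_of_pos hPx0, div_le_iff₀ hPx0]
  have h1 : |Ay / Py| ≤ M := by rwa [abs_div, abs_of_pos hPy0, div_le_iff₀ hPy0]
  calc |(Ax - Ay) + Ay / Py * (Py - Px)| ≤ |Ax - Ay| + |Ay / Py| * |Py - Px| := by
        rw [← abs_mul]; exact abs_add_le _ _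
    _ ≤ K * M + M * K := by gcongr
    _ = 2 * S.card * (dist x y / r) * M * 1 := by rw [hK]; ring
    _ ≤ _ := by gcongr

theorem continuous_netMean {N : Set X} (hr : 0 < r) (hcov : ∀ x : X, ∃ z ∈ N, dist x z < r)
    (hfin : ∀ x : X, {z : N | dist x z < 4 * r}.Finite) (a : N → ℝ) :
    Continuous (netMean N r a) := by
  rw [continuous_iff_continuousAt]
  intro x
  set S := (hfin x).toFinset with hSdef
  have hS : ∀ y ∈ Metric.ball x r, ∀ z : N, dist y z < 2 * r → z ∈ S := by
    intro y hy z hz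
    rw [hSdef, Set.Finite.mem_toFinset, Set.mem_ofPred_eq]
    have := dist_triangle_left x z y
    have := Metric.mem_ball.1 hy
    linarith
  have hev : (fun y => (∑ z ∈ S, netBump r (z : X) y * a z) / ∑ z ∈ S, netBump r (z : X) y) =ᶠ[nhds x]
      netMean N r a :=
    Filter.mem_of_superset (Metric.ball_mem_nhds x hr) fun y hy =>
      (netMean_eq hr a S (hS y hy)).symm
  refine ContinuousAt.congr ?_ hev
  refine ContinuousAt.div ?_ ?_ ?_
  · exact (continuous_finsetSum _ fun z _ => (continuous_netBump _).mul_const _).continuousAt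
  · exact (continuous_finsetSum _ fun z _ => continuous_netBump _).continuousAt
  · have := one_le_sum_netBump hr hcov S (hS x (Metric.mem_ball_self hr))
    linarith

end Bump

/-! ### Continuous approximation at one scale -/

/-- Suprema obey this with constant `1` for every `p > 0`, whereas sums would need `p ≤ 1`; this is
why majorants are built as suprema. -/
theorem ENNReal.iSup_rpow_le_tsum {ι : Type*} (a : ι → ℝ≥0∞) {p : ℝ} (hp : 0 < p) :
    (⨆ i, a i) ^ p ≤ ∑' i, a i ^ p := by
  rw [← ENNReal.le_rpow_inv_iff hp]
  refine iSup_le fun i => ?_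
  rw [ENNReal.le_rpow_inv_iff hp]
  exact ENNReal.le_tsum i

theorem lintegral_iSup_rpow_le_tsum {X ι : Type*} [MeasurableSpace X] {μ : Measure X} [Countable ι]
    {F : ι → X → ℝ≥0∞} (hF : ∀ i, AEMeasurable (F i) μ) {p : ℝ} (hp : 0 < p) :
    ∫⁻ x, (⨆ i, F i x) ^ p ∂μ ≤ ∑' i, ∫⁻ x, F i x ^ p ∂μ := by
  rw [← lintegral_tsum fun i => (hF i).pow_const p]
  exact lintegral_mono fun x => ENNReal.iSup_rpow_le_tsum _ hp

/-- If `|f x - f y| ≤ h x + h y` at distances below `8 r`, then `f` has a continuous approximation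
at scale `r`, whose distance to `f` and whose local Lipschitz constants are controlled by `h`
and a function `H` with `‖H‖_p ≤ C ‖h‖_p`. -/
theorem IsDoublingMeasure.exists_continuous_approx {X : Type*} [MetricSpace X] [MeasurableSpace X]
    [BorelSpace X] {μ : Measure X} (hμ : IsDoublingMeasure μ) :
    ∃ C L : ℝ≥0, ∀ {r p : ℝ}, 0 < r → 0 < p → ∀ {f : X → ℝ} {h : X → ℝ≥0∞} {E : Set X},
      μ E = 0 → AEMeasurable h μ → ∫⁻ x, h x ^ p ∂μ ≠ ∞ →
      (∀ x y, x ∉ E → y ∉ E → dist x y < 8 * r → ENNReal.ofReal |f x - f y| ≤ h x + h y) →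
      ∃ (v : X → ℝ) (H : X → ℝ≥0∞), Continuous v ∧ Measurable H ∧
        ∫⁻ x, H x ^ p ∂μ ≤ C * ∫⁻ x, h x ^ p ∂μ ∧
        (∀ x, x ∉ E → ENNReal.ofReal |f x - v x| ≤ h x + H x) ∧
        ∀ x y, x ∉ E → dist x y < r →
          ENNReal.ofReal |v x - v y| ≤ L * ENNReal.ofReal (dist x y / r) * (h x + H x) := by
  obtain ⟨c, hc⟩ := hμ.doubling
  refine ⟨c ^ 3, 2 * c ^ 5, ?_⟩
  intro r p hr hp f h E hE hh hfin hf
  obtain ⟨N, hN, hcov⟩ := exists_separated_net (X := X) hr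
  have : Countable N := hμ.countable_net hr hN
  have hpos : ∀ z : N, μ (Metric.ball (z : X) (r / 2)) ≠ 0 := fun z =>
    (hμ.ball_pos _ _ (by positivity)).ne'
  have hlt : ∀ z : N, μ (Metric.ball (z : X) (r / 2)) ≠ ∞ := fun z =>
    (hμ.ball_lt_top _ _ (by positivity)).ne
  -- Sample points: somewhere in the ball, off `E`, the value of `h ^ p` is at most its mean.
  -- Putting `Bᶜ` into the null set to be avoided forces the point into the ball.
  have hpt : ∀ z : N, ∃ x ∈ Metric.ball (z : X) (r / 2), x ∉ E ∧
      μ (Metric.ball (z : X) (r / 2)) * h x ^ p ≤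
        ∫⁻ y in Metric.ball (z : X) (r / 2), h y ^ p ∂μ := by
    intro z
    set B := Metric.ball (z : X) (r / 2) with hB
    have hB' : MeasurableSet B := Metric.isOpen_ball.measurableSet
    have : IsFiniteMeasure (μ.restrict B) :=
      ⟨by rw [Measure.restrict_apply_univ]; exact (hlt z).lt_top⟩
    obtain ⟨x, hx, hle⟩ := exists_notMem_null_le_laverage (μ := μ.restrict B)
      (f := fun y => h y ^ p) (N := E ∪ Bᶜ) (by simpa using hpos z) ((hh.pow_const p).restrict) (by
        refine measure_union_null (Measure.restrict_le_self.absolutelyContinuous hE) ?_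
        rw [Measure.restrict_apply hB'.compl, Set.compl_inter_self, measure_empty])
    rw [Set.mem_union, not_or, Set.notMem_compl_iff] at hx
    refine ⟨x, hx.2, hx.1, ?_⟩
    calc μ B * h x ^ p ≤ μ B * ⨍⁻ y in B, h y ^ p ∂μ := by gcongr
      _ = _ := measure_mul_setLAverage _ (hlt z)
  choose a haB haE hale using hpt
  -- Radius `4 * r` reaches every net point that has weight at `x` or at some `y` with `dist x y <
  -- r`, since `2r + r < 4r`.
  set F : N → X → ℝ≥0∞ := fun z => (Metric.ball (z : X) (4 * r)).indicator fun _ => h (a z)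
    with hF
  have hFm : ∀ z, Measurable (F z) := fun z =>
    measurable_const.indicator Metric.isOpen_ball.measurableSet
  have hle : ∀ (x : X) (z : N), dist x z < 4 * r → h (a z) ≤ ⨆ w, F w x := fun x z hz =>
    le_iSup_of_le z (by rw [hF]; simp only; rw [Set.indicator_of_mem (Metric.mem_ball.2 hz)])
  have hdist : ∀ (x : X) (z : N), dist x z < 4 * r → dist (a z) x < 8 * r := fun x z hz => by
    have h1 := dist_triangle_right (a z) x z
    have h2 := Metric.mem_ball.1 (haB z)
    linarith
  have hbd : ∀ x, x ∉ E → h x + (⨆ w, F w x) ≠ ∞ → ∀ z : N, dist x z < 4 * r →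
      |f (a z) - f x| ≤ (h x + ⨆ w, F w x).toReal := fun x hx hfin z hz => by
    rw [← ENNReal.ofReal_le_iff_le_toReal hfin]
    refine (hf _ _ (haE z) hx (hdist x z hz)).trans ?_
    rw [add_comm]
    gcongr
    exact hle x z hz
  have hfinN := hμ.finite_net hr hN
  refine ⟨netMean N r fun z => f (a z), fun x => ⨆ z, F z x, continuous_netMean hr hcov hfinN _,
    Measurable.iSup hFm, ?_, ?_, ?_⟩
  · calc ∫⁻ x, (⨆ z, F z x) ^ p ∂μ ≤ ∑' z, ∫⁻ x, F z x ^ p ∂μ :=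
          lintegral_iSup_rpow_le_tsum (fun z => (hFm z).aemeasurable) hp
      _ ≤ ∑' z : N, (c : ℝ≥0∞) ^ 3 * ∫⁻ y in Metric.ball (z : X) (r / 2), h y ^ p ∂μ := by
          refine ENNReal.tsum_le_tsum fun z => ?_
          have h1 : ∀ x, F z x ^ p =
              (Metric.ball (z : X) (4 * r)).indicator (fun _ => h (a z) ^ p) x := by
            intro x
            by_cases hx : x ∈ Metric.ball (z : X) (4 * r)
            · simp only [hF, Set.indicator_of_mem hx]
            · simp only [hF, Set.indicator_of_notMem hx, ENNReal.zero_rpow_of_pos hp]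
          simp only [h1]
          rw [lintegral_indicator_const Metric.isOpen_ball.measurableSet, mul_comm]
          have h2 := IsDoublingMeasure.measure_ball_two_pow_mul_le hc 3 z (r := r / 2)
            (by positivity)
          rw [show (2 : ℝ) ^ 3 * (r / 2) = 4 * r by ring] at h2
          calc μ (Metric.ball (z : X) (4 * r)) * h (a z) ^ p
              ≤ (c : ℝ≥0∞) ^ 3 * μ (Metric.ball (z : X) (r / 2)) * h (a z) ^ p := by gcongr
            _ ≤ _ := by rw [mul_assoc]; gcongr; exact hale z
      _ = (c : ℝ≥0∞) ^ 3 * ∫⁻ y in ⋃ z : N, Metric.ball (z : X) (r / 2), h y ^ p ∂μ := by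
          rw [ENNReal.tsum_mul_left, lintegral_iUnion
            (fun _ => Metric.isOpen_ball.measurableSet)
            (IsDoublingMeasure.pairwise_disjoint_ball hN)]
      _ ≤ _ := by
          push_cast
          gcongr
          exact Measure.restrict_le_self
  · intro x hx
    by_cases hM : h x + (⨆ w, F w x) = ∞
    · simp only [hM, le_top]
    · rw [ENNReal.ofReal_le_iff_le_toReal hM, abs_sub_comm]
      refine abs_netMean_sub_le hr hcov _ _ (hfinN x).toFinset ?_ ?_
      · intro z hz
        rw [Set.Finite.mem_toFinset, Set.mem_ofPred_eq]
        linarith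
      · intro z hz
        rw [Set.Finite.mem_toFinset, Set.mem_ofPred_eq] at hz
        exact hbd x hx hM z hz
  · intro x y hx hxy
    rcases eq_or_ne x y with rfl | hne
    · simp
    have hd : 0 < dist x y / r := div_pos (dist_pos.2 hne) hr
    by_cases hM : h x + (⨆ w, F w x) = ∞
    -- Since `0 * ∞ = 0`, an infinite majorant makes the bound trivial only if `L ≠ 0`; `c = 0` is
    -- excluded because balls have positive measure.
    · by_cases hc0 : c = 0
      · exfalso
        have h1 := hc x r hr
        rw [hc0, ENNReal.coe_zero, zero_mul] at h1
        exact (hμ.ball_pos x (2 * r) (by positivity)).ne' (le_antisymm h1 bot_le)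
      · simp only [hM]
        rw [ENNReal.mul_top]
        · exact le_top
        · have h3 : ((2 * c ^ 5 : ℝ≥0) : ℝ≥0∞) ≠ 0 :=
            ENNReal.coe_ne_zero.2 (mul_ne_zero two_ne_zero (pow_ne_zero _ hc0))
          exact mul_ne_zero h3 (ENNReal.ofReal_pos.2 hd).ne'
    · have hmem : ∀ z : N, z ∈ (hfinN x).toFinset ↔ dist x z < 4 * r := fun z => by
        rw [Set.Finite.mem_toFinset, Set.mem_ofPred_eq]
      have h1 := abs_netMean_sub_netMean_le hr hcov (fun z => f (a z)) (f x) (x := x) (y := y)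
        (hfinN x).toFinset (fun z hz => (hmem z).2 (by linarith))
        (fun z hz => (hmem z).2 (by
          have := dist_triangle x y z
          linarith)) ENNReal.toReal_nonneg (fun z hz => hbd x hx hM z ((hmem z).1 hz))
      have hcard := hμ.card_net_le hc hr hN x (hfinN x).toFinset fun z hz => (hmem z).1 hz
      calc ENNReal.ofReal |netMean N r (fun z => f (a z)) x - netMean N r (fun z => f (a z)) y|
          ≤ ENNReal.ofReal (2 * (c : ℝ) ^ 5 * (dist x y / r) * (h x + ⨆ w, F w x).toReal) := by
            refine ENNReal.ofReal_le_ofReal (h1.trans ?_)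
            gcongr
        _ = _ := by
            rw [ENNReal.ofReal_mul (by positivity), ENNReal.ofReal_toReal hM,
              ENNReal.ofReal_mul (by positivity)]
            congr 2
            rw [← ENNReal.ofReal_coe_nnreal]
            push_cast
            rfl

/-! ### Quasi-norm inequalities and geometric weights -/

theorem ENNReal.add_rpow_le_two_rpow_mul (a b : ℝ≥0∞) {t : ℝ} (ht : 0 < t) :
    (a + b) ^ t ≤ 2 ^ t * (a ^ t + b ^ t) := by
  wlog h : a ≤ b generalizing a b
  · rw [add_comm a, add_comm (a ^ t)]
    exact this b a (le_of_not_ge h)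
  calc (a + b) ^ t ≤ (2 * b) ^ t := by
        rw [two_mul]; gcongr
    _ = 2 ^ t * b ^ t := ENNReal.mul_rpow_of_nonneg _ _ ht.le
    _ ≤ _ := by gcongr; exact le_add_self

theorem lintegral_add_rpow_le {X : Type*} [MeasurableSpace X] {μ : Measure X} {F G : X → ℝ≥0∞}
    (hF : AEMeasurable F μ) {p : ℝ} (hp : 0 < p) :
    ∫⁻ x, (F x + G x) ^ p ∂μ ≤ 2 ^ p * (∫⁻ x, F x ^ p ∂μ + ∫⁻ x, G x ^ p ∂μ) := by
  have h2 : (2 : ℝ≥0∞) ^ p ≠ ∞ := ENNReal.rpow_ne_top_of_nonneg hp.le ENNReal.ofNat_ne_top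
  rw [← lintegral_add_left' (hF.pow_const p), ← lintegral_const_mul' _ _ h2]
  exact lintegral_mono fun x => ENNReal.add_rpow_le_two_rpow_mul _ _ hp

theorem lintegral_const_mul_rpow {X : Type*} [MeasurableSpace X] {μ : Measure X} (F : X → ℝ≥0∞)
    {a : ℝ≥0∞} (ha : a ≠ ∞) {p : ℝ} (hp : 0 < p) :
    ∫⁻ x, (a * F x) ^ p ∂μ = a ^ p * ∫⁻ x, F x ^ p ∂μ := by
  rw [← lintegral_const_mul' _ _ (ENNReal.rpow_ne_top_of_nonneg hp.le ha)]
  exact lintegral_congr fun x => ENNReal.mul_rpow_of_nonneg _ _ hp.le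

theorem ENNReal.tsum_pow_natAbs_ne_top {w : ℝ≥0∞} (hw : w < 1) :
    ∑' k : ℤ, w ^ k.natAbs ≠ ∞ := by
  have hgeo : ∑' j : ℕ, w ^ j ≠ ∞ := by
    rw [ENNReal.tsum_geometric]
    exact ENNReal.inv_ne_top.2 (tsub_pos_of_lt hw).ne'
  have h := HasSum.of_nat_of_neg_add_one (f := fun k : ℤ => w ^ k.natAbs)
    ENNReal.summable.hasSum ENNReal.summable.hasSum
  rw [h.tsum_eq]
  refine ENNReal.add_ne_top.2 ⟨by simpa using hgeo, ne_top_of_le_ne_top hgeo ?_⟩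
  refine ENNReal.tsum_le_tsum fun j => ?_
  rw [show (-((j : ℤ) + 1)).natAbs = j + 1 by omega, pow_succ]
  exact mul_le_of_le_one_right' hw.le

theorem ENNReal.tsum_pow_natAbs_sub (w : ℝ≥0∞) (n : ℤ) :
    ∑' k : ℤ, w ^ (k - n).natAbs = ∑' k : ℤ, w ^ k.natAbs :=
  (Equiv.subRight n).tsum_eq fun k : ℤ => w ^ k.natAbs

theorem ENNReal.tsum_ite_le_tsum_nat_add (a : ℤ → ℝ≥0∞) {m n : ℤ} (hmn : m ≤ n) :
    ∑' k : ℤ, (if n ≤ k then a k else 0) ≤ ∑' j : ℕ, a (j + m) := by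
  have hinj : Function.Injective fun j : ℕ => (j : ℤ) + m := fun i j h => by
    simpa using h
  rw [← hinj.tsum_eq (f := fun k : ℤ => if n ≤ k then a k else 0)]
  · refine ENNReal.tsum_le_tsum fun j => ?_
    split_ifs
    · exact le_rfl
    · exact bot_le
  · intro k hk
    rw [Function.mem_support] at hk
    have hnk : n ≤ k := by
      by_contra h
      exact hk (if_neg h)
    exact ⟨(k - m).toNat, by simp only; omega⟩

/-- Split `d / r = (d / r) ^ s * (d / r) ^ (1 - s)` with `r = 2 ^ (-n)`; the second factor decays
like `2 ^ (-δ (k - n))`. This turns a Lipschitz bound at scale `r` into a fractional gradient at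
finer scales. -/
theorem div_le_rpow_mul_of_lt_two_zpow {s δ : ℝ} (hδ1 : δ ≤ 1 - s) (hδ0 : 0 ≤ δ)
    {n k : ℤ} (hnk : n ≤ k) {d : ℝ} (hd : 0 < d) (hdk : d < (2 : ℝ) ^ (-k)) :
    d / (2 : ℝ) ^ (-n) ≤
      d ^ s * (((2 : ℝ) ^ (-δ)) ^ (k - n).natAbs * (((2 : ℝ) ^ (-n)) ^ s)⁻¹) := by
  set r : ℝ := (2 : ℝ) ^ (-n) with hr
  have hr0 : 0 < r := by positivity
  obtain ⟨j, rfl⟩ : ∃ j : ℕ, k = n + j := ⟨(k - n).toNat, by omega⟩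
  have hjr : (2 : ℝ) ^ (-(n + j : ℤ)) = (2 : ℝ) ^ (-(j : ℝ)) * r := by
    rw [Real.rpow_neg two_pos.le, Real.rpow_natCast, hr, neg_add, zpow_add₀ two_ne_zero, mul_comm,
      zpow_neg _ (j : ℤ), zpow_natCast]
  have h1 : d / r ≤ (2 : ℝ) ^ (-(j : ℝ)) := by
    rw [div_le_iff₀ hr0, ← hjr]; exact hdk.le
  have h1' : d / r ≤ 1 := h1.trans
    (Real.rpow_le_one_of_one_le_of_nonpos one_le_two (by simp))
  have hdr : 0 < d / r := by positivity
  have h2 : (d / r) ^ (1 - s) ≤ ((2 : ℝ) ^ (-δ)) ^ j := by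
    calc (d / r) ^ (1 - s) ≤ (d / r) ^ δ := Real.rpow_le_rpow_of_exponent_ge hdr h1' hδ1
      _ ≤ ((2 : ℝ) ^ (-(j : ℝ))) ^ δ := Real.rpow_le_rpow hdr.le h1 hδ0
      _ = _ := by
        rw [← Real.rpow_natCast, ← Real.rpow_mul two_pos.le, ← Real.rpow_mul two_pos.le]
        congr 1
        ring
  have h3 : (n + (j : ℤ) - n).natAbs = j := by omega
  rw [h3]
  calc d / r = (d / r) ^ s * (d / r) ^ (1 - s) := by
        rw [← Real.rpow_add hdr]; simp
    _ ≤ (d / r) ^ s * ((2 : ℝ) ^ (-δ)) ^ j := by gcongr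
    _ = _ := by rw [Real.div_rpow hd.le hr0.le]; ring

/-- At coarse scales `(d / r) ^ s` is at least `2 ^ (s (n - k))` up to the factor `2 ^ s ≤ 2`, lost
because `d` may be only `2 ^ (-k - 1)`. Thus a pointwise bound becomes a fractional gradient with
decaying weights. -/
theorem one_le_rpow_mul_of_two_zpow_le {s δ : ℝ} (hs0 : 0 < s) (hs1 : s < 1) (hδ1 : δ ≤ s)
    {n k : ℤ} (hnk : k < n) {d : ℝ} (hdk : (2 : ℝ) ^ (-k - 1) ≤ d) :
    1 ≤ d ^ s * (2 * ((2 : ℝ) ^ (-δ)) ^ (k - n).natAbs * (((2 : ℝ) ^ (-n)) ^ s)⁻¹) := by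
  set r : ℝ := (2 : ℝ) ^ (-n) with hr
  have hr0 : 0 < r := by positivity
  have hd : 0 < d := lt_of_lt_of_le (by positivity) hdk
  obtain ⟨j, rfl⟩ : ∃ j : ℕ, n = k + j := ⟨(n - k).toNat, by omega⟩
  have h3 : (k - (k + (j : ℤ))).natAbs = j := by omega
  rw [h3]
  have hjr : (2 : ℝ) ^ (j : ℝ) * r ≤ 2 * d := by
    have : (2 : ℝ) ^ (j : ℝ) * r = 2 * (2 : ℝ) ^ (-k - 1) := by
      rw [hr, Real.rpow_natCast, ← zpow_natCast, ← zpow_add₀ two_ne_zero, ← zpow_one_add₀ two_ne_zero]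
      congr 1
      ring
    rw [this]
    gcongr
  have h1 : ((2 : ℝ) ^ (j : ℝ) * r) ^ s ≤ 2 * d ^ s := by
    refine (Real.rpow_le_rpow (by positivity) hjr hs0.le).trans ?_
    rw [Real.mul_rpow two_pos.le hd.le]
    gcongr
    calc (2 : ℝ) ^ s ≤ 2 ^ (1 : ℝ) := Real.rpow_le_rpow_of_exponent_le one_le_two hs1.le
      _ = 2 := Real.rpow_one 2
  have h2 : 1 ≤ ((2 : ℝ) ^ (j : ℝ)) ^ s * ((2 : ℝ) ^ (-δ)) ^ j := by
    rw [← Real.rpow_natCast ((2 : ℝ) ^ (-δ)), ← Real.rpow_mul two_pos.le,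
      ← Real.rpow_mul two_pos.le, ← Real.rpow_add two_pos]
    refine Real.one_le_rpow one_le_two ?_
    have : 0 ≤ (j : ℝ) * (s - δ) := mul_nonneg (by positivity) (by linarith)
    linarith
  rw [Real.mul_rpow (by positivity) hr0.le] at h1
  have hrs : 0 < r ^ s := by positivity
  calc (1 : ℝ) ≤ ((2 : ℝ) ^ (j : ℝ)) ^ s * ((2 : ℝ) ^ (-δ)) ^ j := h2
    _ = (((2 : ℝ) ^ (j : ℝ)) ^ s * r ^ s) * (((2 : ℝ) ^ (-δ)) ^ j * (r ^ s)⁻¹) := by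
        field_simp
    _ ≤ (2 * d ^ s) * (((2 : ℝ) ^ (-δ)) ^ j * (r ^ s)⁻¹) := by gcongr
    _ = _ := by ring

/-! ### Approximation errors with small fractional gradients -/

/-- The combined effect at scales below `2 ^ (-m)` of a fractional `s`-gradient `(g k)`. -/
noncomputable def fineMajorant {X : Type*} (s : ℝ) (g : ℤ → X → ℝ≥0∞) (m : ℤ) (x : X) : ℝ≥0∞ :=
  ⨆ j : ℕ, ENNReal.ofReal ((2 : ℝ) ^ (-s)) ^ j * g (j + m) x

theorem aemeasurable_fineMajorant {X : Type*} [MeasurableSpace X] {μ : Measure X} {s : ℝ}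
    {g : ℤ → X → ℝ≥0∞} (hg : ∀ k, AEMeasurable (g k) μ) (m : ℤ) :
    AEMeasurable (fineMajorant s g m) μ :=
  AEMeasurable.iSup fun _ => (hg _).const_mul _

/-- If `x ≠ y`, their distance lies in one dyadic range `k = j + m`, where `d ^ s ≤ 2 ^ (-m s) * 2 ^
(-j s)`; the last factor is the weight in `fineMajorant`. -/
theorem ofReal_abs_sub_le_fineMajorant {X : Type*} [MetricSpace X] {s : ℝ} (hs : 0 < s)
    {f : X → ℝ} {g : ℤ → X → ℝ≥0∞} {x y : X}
    (hg : ∀ k : ℤ, (2 : ℝ) ^ (-k - 1) ≤ dist x y → dist x y < (2 : ℝ) ^ (-k) →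
      ENNReal.ofReal |f x - f y| ≤ ENNReal.ofReal (dist x y ^ s) * (g k x + g k y))
    (m : ℤ) (hxy : dist x y < (2 : ℝ) ^ (-m)) :
    ENNReal.ofReal |f x - f y| ≤ ENNReal.ofReal (((2 : ℝ) ^ (-m)) ^ s) *
      (fineMajorant s g m x + fineMajorant s g m y) := by
  rcases eq_or_ne x y with rfl | hne
  · simp
  have hd := dist_pos.2 hne
  obtain ⟨i, hi1, hi2⟩ := exists_mem_Ico_zpow hd one_lt_two
  obtain ⟨k, rfl⟩ : ∃ k : ℤ, i = -k - 1 := ⟨-i - 1, by ring⟩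
  rw [sub_add_cancel] at hi2
  have hmk : m ≤ k := by
    have := (zpow_lt_zpow_iff_right₀ (one_lt_two (α := ℝ))).1 (hi1.trans_lt hxy)
    omega
  obtain ⟨j, rfl⟩ : ∃ j : ℕ, k = j + m := ⟨(k - m).toNat, by omega⟩
  have hle : ∀ z, ENNReal.ofReal ((2 : ℝ) ^ (-s)) ^ j * g (j + m) z ≤ fineMajorant s g m z :=
    fun z => le_iSup (fun j : ℕ => ENNReal.ofReal ((2 : ℝ) ^ (-s)) ^ j * g (j + m) z) j
  have hpow : dist x y ^ s ≤ ((2 : ℝ) ^ (-m)) ^ s * ((2 : ℝ) ^ (-s)) ^ j := by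
    calc dist x y ^ s ≤ ((2 : ℝ) ^ (-(j + m : ℤ))) ^ s :=
          Real.rpow_le_rpow hd.le hi2.le hs.le
      _ = _ := by
        rw [neg_add_rev, zpow_add₀ two_ne_zero, Real.mul_rpow (by positivity) (by positivity),
          ← Real.rpow_natCast, ← Real.rpow_intCast 2 (-(j : ℤ)), ← Real.rpow_mul two_pos.le,
          ← Real.rpow_mul two_pos.le]
        congr 2
        push_cast
        ring
  calc ENNReal.ofReal |f x - f y|
      ≤ ENNReal.ofReal (dist x y ^ s) * (g (j + m) x + g (j + m) y) := hg _ hi1 hi2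
    _ ≤ ENNReal.ofReal (((2 : ℝ) ^ (-m)) ^ s * ((2 : ℝ) ^ (-s)) ^ j) *
        (g (j + m) x + g (j + m) y) := by gcongr
    _ = ENNReal.ofReal (((2 : ℝ) ^ (-m)) ^ s) * (ENNReal.ofReal ((2 : ℝ) ^ (-s)) ^ j * g (j + m) x +
        ENNReal.ofReal ((2 : ℝ) ^ (-s)) ^ j * g (j + m) y) := by
        rw [ENNReal.ofReal_mul (by positivity), ENNReal.ofReal_pow (by positivity)]
        ring
    _ ≤ _ := by gcongr <;> exact hle _

/-- Each integral is at most the whole `ℓ^t` quantity and the weights form a geometric series, so no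
Hölder inequality or restriction on `t` is needed. -/
theorem lintegral_fineMajorant_rpow_le {X : Type*} [MeasurableSpace X] {μ : Measure X} {s p t : ℝ}
    (hp : 0 < p) (ht : 0 < t) {g : ℤ → X → ℝ≥0∞} (hg : ∀ k, AEMeasurable (g k) μ)
    (m : ℤ) :
    ∫⁻ x, fineMajorant s g m x ^ p ∂μ ≤ (1 - ENNReal.ofReal ((2 : ℝ) ^ (-s)) ^ p)⁻¹ *
      (∑' j : ℕ, (∫⁻ x, g (j + m) x ^ p ∂μ) ^ t) ^ t⁻¹ := by
  set l := ENNReal.ofReal ((2 : ℝ) ^ (-s)) with hl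
  have hl' : ∀ j : ℕ, l ^ j ≠ ∞ := fun j => ENNReal.pow_ne_top ENNReal.ofReal_ne_top
  calc ∫⁻ x, fineMajorant s g m x ^ p ∂μ
      ≤ ∑' j : ℕ, ∫⁻ x, (l ^ j * g (j + m) x) ^ p ∂μ :=
        lintegral_iSup_rpow_le_tsum (fun j => (hg _).const_mul _) hp
    _ = ∑' j : ℕ, (l ^ p) ^ j * ∫⁻ x, g (j + m) x ^ p ∂μ := by
        congr 1 with j
        rw [lintegral_const_mul_rpow _ (hl' j) hp, ← ENNReal.rpow_natCast, ← ENNReal.rpow_natCast,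
          ← ENNReal.rpow_mul, ← ENNReal.rpow_mul, mul_comm p]
    _ ≤ ∑' j : ℕ, (l ^ p) ^ j * (∑' j : ℕ, (∫⁻ x, g (j + m) x ^ p ∂μ) ^ t) ^ t⁻¹ := by
        refine ENNReal.tsum_le_tsum fun j => mul_le_mul_right ?_ _
        rw [ENNReal.le_rpow_inv_iff ht]
        exact ENNReal.le_tsum (f := fun j : ℕ => (∫⁻ x, g (j + m) x ^ p ∂μ) ^ t) j
    _ = _ := by rw [ENNReal.tsum_mul_right, ENNReal.tsum_geometric]

/-- Approximation at scale `2 ^ (-m)`: the error is controlled by the tail of the fractional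
gradient. -/
theorem IsDoublingMeasure.exists_continuous_approx_tail {X : Type*} [MetricSpace X]
    [MeasurableSpace X] [BorelSpace X] {μ : Measure X} (hμ : IsDoublingMeasure μ) {s p t : ℝ}
    (hs0 : 0 < s) (hs1 : s < 1) (hp : 0 < p) (ht : 0 < t) :
    ∃ K : ℝ≥0∞, K ≠ ∞ ∧ ∀ {f : X → ℝ} {g : ℤ → X → ℝ≥0∞} {E : Set X}, μ E = 0 →
      (∀ k, AEMeasurable (g k) μ) →
      (∀ (k : ℤ) (x y : X), x ∉ E → y ∉ E → (2 : ℝ) ^ (-k - 1) ≤ dist x y →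
        dist x y < (2 : ℝ) ^ (-k) →
        ENNReal.ofReal |f x - f y| ≤ ENNReal.ofReal (dist x y ^ s) * (g k x + g k y)) →
      ∀ m : ℕ, ∑' j : ℕ, (∫⁻ x, g (j + m) x ^ p ∂μ) ^ t ≠ ∞ →
      ∃ (v : X → ℝ) (D : X → ℝ≥0∞) (G : ℤ → X → ℝ≥0∞), Continuous v ∧ AEMeasurable D μ ∧
        (∀ k, AEMeasurable (G k) μ) ∧ (∀ x, x ∉ E → ENNReal.ofReal |f x - v x| ≤ D x) ∧
        (∀ (k : ℤ) (x y : X), x ∉ E → y ∉ E → (2 : ℝ) ^ (-k - 1) ≤ dist x y →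
          dist x y < (2 : ℝ) ^ (-k) →
          ENNReal.ofReal |(f x - v x) - (f y - v y)| ≤
            ENNReal.ofReal (dist x y ^ s) * (G k x + G k y)) ∧
        ∫⁻ x, D x ^ p ∂μ ≤ K * (∑' j : ℕ, (∫⁻ x, g (j + m) x ^ p ∂μ) ^ t) ^ t⁻¹ ∧
        ∑' k, (∫⁻ x, G k x ^ p ∂μ) ^ t ≤ K * ∑' j : ℕ, (∫⁻ x, g (j + m) x ^ p ∂μ) ^ t := by
  obtain ⟨C, L, hCL⟩ := hμ.exists_continuous_approx
  set l := ENNReal.ofReal ((2 : ℝ) ^ (-s)) with hl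
  -- One decay rate for both sides: `1 - s` governs scales finer than `r`, and `s` the coarser ones.
  set δ := min s (1 - s) with hδ
  have hδ0 : 0 < δ := lt_min hs0 (by linarith)
  set κ := ENNReal.ofReal ((2 : ℝ) ^ (-δ)) with hκ
  have hlt : ∀ {a : ℝ}, 0 < a → ENNReal.ofReal ((2 : ℝ) ^ (-a)) < 1 := fun ha => by
    rw [← ENNReal.ofReal_one, ENNReal.ofReal_lt_ofReal_iff one_pos]
    exact Real.rpow_lt_one_of_one_lt_of_neg one_lt_two (by linarith)
  have hΛ : (1 - l ^ p)⁻¹ ≠ ∞ := ENNReal.inv_ne_top.2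
    (tsub_pos_of_lt (ENNReal.rpow_lt_one (hlt hs0) hp)).ne'
  have hw : (κ ^ p) ^ t < 1 :=
    ENNReal.rpow_lt_one (ENNReal.rpow_lt_one (hlt hδ0) hp) ht
  have h2p : (2 : ℝ≥0∞) ^ p ≠ ∞ := ENNReal.rpow_ne_top_of_nonneg hp.le ENNReal.ofNat_ne_top
  -- the constant in `∫ B ^ p ≤ σ ^ p * K₀ * τ ^ (1 / t)`
  set K₀ : ℝ≥0∞ := 2 ^ p * (1 + C) * (1 - l ^ p)⁻¹ with hK₀
  have hK₀' : K₀ ≠ ∞ := ENNReal.mul_ne_top (ENNReal.mul_ne_top h2p (by simp)) hΛ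
  set e : ℝ≥0∞ := ENNReal.ofReal (8 ^ s) with he
  -- `L` serves the Lipschitz bound at fine scales, `2` the loss in
  -- `one_le_rpow_mul_of_two_zpow_le`.
  set A : ℝ≥0∞ := L + 2 with hA
  have hA' : A ≠ ∞ := by simp [hA]
  set W : ℝ≥0∞ := ∑' k : ℤ, ((κ ^ p) ^ t) ^ k.natAbs with hW
  have hW' : W ≠ ∞ := ENNReal.tsum_pow_natAbs_ne_top hw
  set K₁ : ℝ≥0∞ := (2 ^ p) ^ t * (2 ^ t * (1 + W * ((A * e) ^ p * K₀) ^ t)) with hK₁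
  have hAe : (A * e) ^ p ≠ ∞ :=
    ENNReal.rpow_ne_top_of_nonneg hp.le (ENNReal.mul_ne_top hA' ENNReal.ofReal_ne_top)
  have hK₁' : K₁ ≠ ∞ := by
    refine ENNReal.mul_ne_top (ENNReal.rpow_ne_top_of_nonneg ht.le h2p) (ENNReal.mul_ne_top
      (ENNReal.rpow_ne_top_of_nonneg ht.le ENNReal.ofNat_ne_top) (ENNReal.add_ne_top.2
      ⟨ENNReal.one_ne_top, ENNReal.mul_ne_top hW' ?_⟩))
    exact ENNReal.rpow_ne_top_of_nonneg ht.le (ENNReal.mul_ne_top hAe hK₀')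
  refine ⟨K₀ + K₁, ENNReal.add_ne_top.2 ⟨hK₀', hK₁'⟩, ?_⟩
  intro f g E hE hgm hg m hτ
  set τ := ∑' j : ℕ, (∫⁻ x, g (j + m) x ^ p ∂μ) ^ t with hτdef
  -- The shift by `3` gives `8 * r = 2 ^ (-m)`, so distances below `8 * r` involve only `g k` with
  -- `k ≥ m`.
  set n : ℤ := m + 3 with hn
  set r : ℝ := (2 : ℝ) ^ (-n) with hr
  have hr0 : 0 < r := by positivity
  have h8r : 8 * r = (2 : ℝ) ^ (-(m : ℤ)) := by
    rw [hr, hn, neg_add, zpow_add₀ two_ne_zero]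
    norm_num
    ring
  set h := fineMajorant s g m with hh
  have hhm : AEMeasurable h μ := aemeasurable_fineMajorant hgm m
  have hhint : ∫⁻ x, h x ^ p ∂μ ≤ (1 - l ^ p)⁻¹ * τ ^ t⁻¹ :=
    lintegral_fineMajorant_rpow_le hp ht hgm m
  set σ : ℝ≥0∞ := ENNReal.ofReal ((8 * r) ^ s) with hσ
  have hσ' : σ ≠ ∞ := ENNReal.ofReal_ne_top
  have hσint : ∫⁻ x, (σ * h x) ^ p ∂μ ≤ σ ^ p * ((1 - l ^ p)⁻¹ * τ ^ t⁻¹) := by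
    rw [lintegral_const_mul_rpow _ hσ' hp]
    gcongr
  have hτ' : τ ^ t⁻¹ ≠ ∞ := ENNReal.rpow_ne_top_of_nonneg (inv_nonneg.2 ht.le) hτ
  obtain ⟨v, H, hv, hHm, hHint, hfv, hvv⟩ := hCL hr0 hp (f := f) (h := fun x => σ * h x) hE
    (hhm.const_mul σ) (ne_top_of_le_ne_top (ENNReal.mul_ne_top
      (ENNReal.rpow_ne_top_of_nonneg hp.le hσ') (ENNReal.mul_ne_top hΛ hτ')) hσint)
    (fun x y hx hy hxy => by
      rw [← mul_add, hσ, h8r]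
      exact ofReal_abs_sub_le_fineMajorant hs0 (fun k => hg k x y hx hy) m (h8r ▸ hxy))
  set B : X → ℝ≥0∞ := fun x => σ * h x + H x with hB
  have hBm : AEMeasurable B μ := (hhm.const_mul σ).add hHm.aemeasurable
  have hBint : ∫⁻ x, B x ^ p ∂μ ≤ σ ^ p * (K₀ * τ ^ t⁻¹) := by
    calc ∫⁻ x, B x ^ p ∂μ ≤ 2 ^ p * (∫⁻ x, (σ * h x) ^ p ∂μ + ∫⁻ x, H x ^ p ∂μ) :=
          lintegral_add_rpow_le (hhm.const_mul σ) hp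
      _ ≤ 2 ^ p * (∫⁻ x, (σ * h x) ^ p ∂μ + C * ∫⁻ x, (σ * h x) ^ p ∂μ) := by gcongr
      _ = 2 ^ p * (1 + C) * ∫⁻ x, (σ * h x) ^ p ∂μ := by ring
      _ ≤ 2 ^ p * (1 + C) * (σ ^ p * ((1 - l ^ p)⁻¹ * τ ^ t⁻¹)) := by gcongr
      _ = _ := by rw [hK₀]; ring
  set ν : ℝ≥0∞ := ENNReal.ofReal (r ^ s)⁻¹ with hν
  have hνσ : ν * σ = e := by
    rw [hν, hσ, he, ← ENNReal.ofReal_mul (by positivity), Real.mul_rpow (by norm_num) hr0.le]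
    congr 1
    field_simp
  set b : ℤ → ℝ≥0∞ := fun k => A * κ ^ (k - n).natAbs * ν with hb
  have hb' : ∀ k, b k ≠ ∞ := fun k => ENNReal.mul_ne_top (ENNReal.mul_ne_top hA'
    (ENNReal.pow_ne_top ENNReal.ofReal_ne_top)) ENNReal.ofReal_ne_top
  -- At coarse scales the bound on `|f - v|` suffices, so the original gradient is cut off there and
  -- only its tail is left.
  set g' : ℤ → X → ℝ≥0∞ := fun k x => if n ≤ k then g k x else 0 with hg'
  have hg'm : ∀ k, AEMeasurable (g' k) μ := fun k => by
    by_cases hnk : n ≤ k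
    · simpa only [hg', if_pos hnk] using hgm k
    · simpa only [hg', if_neg hnk] using aemeasurable_const
  refine ⟨v, B, fun k x => g' k x + b k * B x, hv, hBm,
    fun k => (hg'm k).add (hBm.const_mul _), hfv, ?_, ?_, ?_⟩
  · intro k x y hx hy hk1 hk2
    have hd : 0 < dist x y := lt_of_lt_of_le (by positivity) hk1
    rcases le_or_gt n k with hnk | hnk
    · have hdr : dist x y < r := hk2.trans_le (zpow_le_zpow_right₀ one_le_two (by omega))
      have hscal : ENNReal.ofReal (dist x y / r) ≤
          ENNReal.ofReal (dist x y ^ s) * (κ ^ (k - n).natAbs * ν) := by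
        rw [hκ, hν, ← ENNReal.ofReal_pow (by positivity), ← ENNReal.ofReal_mul (by positivity),
          ← ENNReal.ofReal_mul (by positivity)]
        exact ENNReal.ofReal_le_ofReal
          (div_le_rpow_mul_of_lt_two_zpow (min_le_right _ _) hδ0.le hnk hd hk2)
      have hv' : ENNReal.ofReal |v x - v y| ≤ ENNReal.ofReal (dist x y ^ s) * (b k * B x) := by
        calc ENNReal.ofReal |v x - v y| ≤ L * ENNReal.ofReal (dist x y / r) * B x :=
              hvv x y hx hdr
          _ ≤ A * (ENNReal.ofReal (dist x y ^ s) * (κ ^ (k - n).natAbs * ν)) * B x := by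
              gcongr
              exact le_self_add
          _ = _ := by rw [hb]; ring
      calc ENNReal.ofReal |(f x - v x) - (f y - v y)|
          ≤ ENNReal.ofReal (|f x - f y| + |v x - v y|) := by
            refine ENNReal.ofReal_le_ofReal ?_
            rw [show (f x - v x) - (f y - v y) = (f x - f y) - (v x - v y) by ring]
            exact abs_sub _ _
        _ = ENNReal.ofReal |f x - f y| + ENNReal.ofReal |v x - v y| :=
            ENNReal.ofReal_add (abs_nonneg _) (abs_nonneg _)
        _ ≤ ENNReal.ofReal (dist x y ^ s) * (g k x + g k y) +
            ENNReal.ofReal (dist x y ^ s) * (b k * B x) := by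
            gcongr
            exact hg k x y hx hy hk1 hk2
        _ = ENNReal.ofReal (dist x y ^ s) * (g k x + b k * B x + g k y) := by ring
        _ ≤ _ := by
            simp only [hg', if_pos hnk]
            gcongr
            exact le_self_add
    · have hscal : 1 ≤ ENNReal.ofReal (dist x y ^ s) * b k := by
        have h2 : (ENNReal.ofReal 2 : ℝ≥0∞) ≤ A := by
          rw [ENNReal.ofReal_ofNat, hA]; exact le_add_self
        calc (1 : ℝ≥0∞) ≤ ENNReal.ofReal (dist x y ^ s *
                (2 * ((2 : ℝ) ^ (-δ)) ^ (k - n).natAbs * (((2 : ℝ) ^ (-n)) ^ s)⁻¹)) :=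
              ENNReal.one_le_ofReal.2
                (one_le_rpow_mul_of_two_zpow_le hs0 hs1 (min_le_left _ _) hnk hk1)
          _ = ENNReal.ofReal (dist x y ^ s) *
                (ENNReal.ofReal 2 * κ ^ (k - n).natAbs * ν) := by
              rw [hκ, hν, ← ENNReal.ofReal_pow (by positivity), ENNReal.ofReal_mul (by positivity),
                ENNReal.ofReal_mul (by positivity), ENNReal.ofReal_mul (by positivity)]
          _ ≤ _ := by
              simp only [hb]
              gcongr
      calc ENNReal.ofReal |(f x - v x) - (f y - v y)|
          ≤ ENNReal.ofReal (|f x - v x| + |f y - v y|) :=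
            ENNReal.ofReal_le_ofReal (abs_sub _ _)
        _ = ENNReal.ofReal |f x - v x| + ENNReal.ofReal |f y - v y| :=
            ENNReal.ofReal_add (abs_nonneg _) (abs_nonneg _)
        _ ≤ 1 * (B x + B y) := by
            rw [one_mul]
            exact add_le_add (hfv x hx) (hfv y hy)
        _ ≤ ENNReal.ofReal (dist x y ^ s) * b k * (B x + B y) := by gcongr
        _ = ENNReal.ofReal (dist x y ^ s) * (b k * B x + b k * B y) := by ring
        _ ≤ _ := by gcongr <;> exact le_add_self
  -- Here it matters that `m` is a natural number: `8 * r = 2 ^ (-m) ≤ 1`.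
  · have hσ1 : σ ^ p ≤ 1 := by
      refine ENNReal.rpow_le_one ?_ hp.le
      rw [hσ, h8r, ENNReal.ofReal_le_one]
      refine Real.rpow_le_one (by positivity) ?_ hs0.le
      exact zpow_le_one_of_nonpos₀ one_le_two (by omega)
    calc ∫⁻ x, B x ^ p ∂μ ≤ σ ^ p * (K₀ * τ ^ t⁻¹) := hBint
      _ ≤ 1 * ((K₀ + K₁) * τ ^ t⁻¹) := by gcongr; exact le_self_add
      _ = _ := one_mul _
  · have hterm : ∀ k, (∫⁻ x, (g' k x + b k * B x) ^ p ∂μ) ^ t ≤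
        (2 ^ p) ^ t * (2 ^ t * ((if n ≤ k then (∫⁻ x, g k x ^ p ∂μ) ^ t else 0) +
          ((κ ^ p) ^ t) ^ (k - n).natAbs * (((A * e) ^ p * K₀) ^ t * τ))) := by
      intro k
      have hgk : (∫⁻ x, g' k x ^ p ∂μ) ^ t = if n ≤ k then (∫⁻ x, g k x ^ p ∂μ) ^ t else 0 := by
        by_cases hnk : n ≤ k
        · simp only [hg', if_pos hnk]
        · simp [hg', if_neg hnk, ENNReal.zero_rpow_of_pos hp, ENNReal.zero_rpow_of_pos ht]
      have hbk : (∫⁻ x, (b k * B x) ^ p ∂μ) ^ t ≤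
          ((κ ^ p) ^ t) ^ (k - n).natAbs * (((A * e) ^ p * K₀) ^ t * τ) := by
        calc (∫⁻ x, (b k * B x) ^ p ∂μ) ^ t
            = (b k ^ p * ∫⁻ x, B x ^ p ∂μ) ^ t := by rw [lintegral_const_mul_rpow _ (hb' k) hp]
          _ ≤ (b k ^ p * (σ ^ p * (K₀ * τ ^ t⁻¹))) ^ t := by gcongr
          _ = ((κ ^ p) ^ (k - n).natAbs * (((A * e) ^ p * K₀) * τ ^ t⁻¹)) ^ t := by
              congr 1
              rw [← mul_assoc, ← ENNReal.mul_rpow_of_nonneg _ _ hp.le, hb]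
              simp only
              rw [mul_assoc (A * _), hνσ, mul_right_comm, mul_comm (A * e),
                ENNReal.mul_rpow_of_nonneg _ _ hp.le, ← ENNReal.rpow_natCast,
                ← ENNReal.rpow_natCast, ← ENNReal.rpow_mul, ← ENNReal.rpow_mul, mul_comm p]
              ring
          _ = _ := by
              rw [ENNReal.mul_rpow_of_nonneg _ _ ht.le, ENNReal.mul_rpow_of_nonneg _ _ ht.le,
                ENNReal.rpow_inv_rpow ht.ne', ← ENNReal.rpow_natCast, ← ENNReal.rpow_natCast,
                ← ENNReal.rpow_mul, ← ENNReal.rpow_mul _ t, mul_comm t]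
      calc (∫⁻ x, (g' k x + b k * B x) ^ p ∂μ) ^ t
          ≤ (2 ^ p * (∫⁻ x, g' k x ^ p ∂μ + ∫⁻ x, (b k * B x) ^ p ∂μ)) ^ t := by
            gcongr
            exact lintegral_add_rpow_le (hg'm k) hp
        _ = (2 ^ p) ^ t * (∫⁻ x, g' k x ^ p ∂μ + ∫⁻ x, (b k * B x) ^ p ∂μ) ^ t :=
            ENNReal.mul_rpow_of_nonneg _ _ ht.le
        _ ≤ (2 ^ p) ^ t * (2 ^ t * ((∫⁻ x, g' k x ^ p ∂μ) ^ t +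
              (∫⁻ x, (b k * B x) ^ p ∂μ) ^ t)) := by
            gcongr
            exact ENNReal.add_rpow_le_two_rpow_mul _ _ ht
        _ ≤ _ := by
            rw [hgk]
            gcongr
    calc ∑' k, (∫⁻ x, (g' k x + b k * B x) ^ p ∂μ) ^ t
        ≤ ∑' k, (2 ^ p) ^ t * (2 ^ t * ((if n ≤ k then (∫⁻ x, g k x ^ p ∂μ) ^ t else 0) +
          ((κ ^ p) ^ t) ^ (k - n).natAbs * (((A * e) ^ p * K₀) ^ t * τ))) :=
          ENNReal.tsum_le_tsum hterm
      _ = (2 ^ p) ^ t * (2 ^ t * ((∑' k, if n ≤ k then (∫⁻ x, g k x ^ p ∂μ) ^ t else 0) +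
          W * (((A * e) ^ p * K₀) ^ t * τ))) := by
          rw [ENNReal.tsum_mul_left, ENNReal.tsum_mul_left, ENNReal.tsum_add,
            ENNReal.tsum_mul_right, ENNReal.tsum_pow_natAbs_sub]
      _ ≤ (2 ^ p) ^ t * (2 ^ t * (τ + W * (((A * e) ^ p * K₀) ^ t * τ))) := by
          gcongr
          exact ENNReal.tsum_ite_le_tsum_nat_add (fun k => (∫⁻ x, g k x ^ p ∂μ) ^ t) (by omega)
      _ = K₁ * τ := by rw [hK₁]; ring
      _ ≤ _ := by gcongr; exact le_add_self

/-- A function with a fractional `s`-gradient in `l^q(L^p)` has arbitrarily good continuous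
approximations in the Hajłasz–Besov norm. -/
theorem IsDoublingMeasure.exists_continuous_approx_le {X : Type*} [MetricSpace X]
    [MeasurableSpace X] [BorelSpace X] {μ : Measure X} (hμ : IsDoublingMeasure μ) {s p t : ℝ}
    (hs0 : 0 < s) (hs1 : s < 1) (hp : 0 < p) (ht : 0 < t)
    {f : X → ℝ} {g : ℤ → X → ℝ≥0∞} {E : Set X} (hE : μ E = 0)
    (hgm : ∀ k, AEMeasurable (g k) μ)
    (hg : ∀ (k : ℤ) (x y : X), x ∉ E → y ∉ E → (2 : ℝ) ^ (-k - 1) ≤ dist x y →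
      dist x y < (2 : ℝ) ^ (-k) →
      ENNReal.ofReal |f x - f y| ≤ ENNReal.ofReal (dist x y ^ s) * (g k x + g k y))
    (hsum : ∑' k, (∫⁻ x, g k x ^ p ∂μ) ^ t ≠ ∞) {η : ℝ≥0∞} (hη : 0 < η) :
    ∃ (v : X → ℝ) (D : X → ℝ≥0∞) (G : ℤ → X → ℝ≥0∞), Continuous v ∧ AEMeasurable D μ ∧
      (∀ k, AEMeasurable (G k) μ) ∧ (∀ x, x ∉ E → ENNReal.ofReal |f x - v x| ≤ D x) ∧
      (∀ (k : ℤ) (x y : X), x ∉ E → y ∉ E → (2 : ℝ) ^ (-k - 1) ≤ dist x y →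
        dist x y < (2 : ℝ) ^ (-k) →
        ENNReal.ofReal |(f x - v x) - (f y - v y)| ≤
          ENNReal.ofReal (dist x y ^ s) * (G k x + G k y)) ∧
      ∫⁻ x, D x ^ p ∂μ ≤ η ∧ ∑' k, (∫⁻ x, G k x ^ p ∂μ) ^ t ≤ η := by
  obtain ⟨K, hK, happ⟩ := hμ.exists_continuous_approx_tail hs0 hs1 hp ht
  have hnat : ∑' j : ℕ, (∫⁻ x, g (j : ℤ) x ^ p ∂μ) ^ t ≠ ∞ :=
    ne_top_of_le_ne_top hsum (ENNReal.tsum_comp_le_tsum_of_injective Nat.cast_injective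
      fun k : ℤ => (∫⁻ x, g k x ^ p ∂μ) ^ t)
  have htail := ENNReal.tendsto_sum_nat_add (fun j : ℕ => (∫⁻ x, g (j : ℤ) x ^ p ∂μ) ^ t) hnat
  simp only [Nat.cast_add] at htail
  have h1 := ENNReal.Tendsto.const_mul htail (Or.inr hK)
  have h2 := ENNReal.Tendsto.const_mul (htail.ennrpow_const t⁻¹) (Or.inr hK)
  rw [ENNReal.zero_rpow_of_pos (inv_pos.2 ht)] at h2
  rw [mul_zero] at h1 h2
  obtain ⟨m, ⟨hm1, hm2⟩, hm3⟩ := (((h1.eventually_le_const hη).and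
    (h2.eventually_le_const hη)).and (htail.eventually_lt_const ENNReal.zero_lt_top)).exists
  obtain ⟨v, D, G, hv, hD, hG, hfv, hgrad, hDint, hGint⟩ := happ hE hgm hg m hm3.ne
  exact ⟨v, D, G, hv, hD, hG, hfv, hgrad, hDint.trans hm2, hGint.trans hm1⟩

/-! ### Norm formulas and an upper bound for the capacity -/

theorem EReal.abs_coe_ennreal (a : ℝ≥0∞) : (a : EReal).abs = a := by
  induction a with
  | top => rfl
  | coe a =>
    have h : ((a : ℝ≥0∞) : EReal) = ((a : ℝ) : EReal) := rfl
    rw [h, EReal.abs_def, abs_of_nonneg a.coe_nonneg, ENNReal.ofReal_coe_nnreal]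

theorem EReal.abs_coe_ennreal_sub_le {a b R : ℝ≥0∞} (ha : a ≠ ∞) (hb : b ≠ ∞) (hab : a ≤ b + R)
    (hba : b ≤ a + R) : ((a : EReal) - b).abs ≤ R := by
  rcases eq_or_ne R ∞ with rfl | hR
  · exact le_top
  lift a to ℝ≥0 using ha
  lift b to ℝ≥0 using hb
  lift R to ℝ≥0 using hR
  have h : ((a : ℝ≥0∞) : EReal) - ((b : ℝ≥0∞) : EReal) = (((a : ℝ) - b : ℝ) : EReal) := rfl
  have hab' : (a : ℝ) ≤ b + R := by exact_mod_cast hab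
  have hba' : (b : ℝ) ≤ a + R := by exact_mod_cast hba
  rw [h, EReal.abs_def, ENNReal.ofReal_le_iff_le_toReal ENNReal.coe_ne_top, ENNReal.coe_toReal,
    abs_le]
  constructor <;> linarith

theorem eLpNorm_ofReal_eq_lintegral {X : Type*} [MeasurableSpace X] {μ : Measure X}
    {p : ℝ} (hp : 0 < p) (F : X → ℝ≥0∞) :
    eLpNorm F (ENNReal.ofReal p) μ = (∫⁻ x, F x ^ p ∂μ) ^ p⁻¹ := by
  rw [eLpNorm_eq_lintegral_rpow_enorm_toReal (ENNReal.ofReal_pos.2 hp).ne' ENNReal.ofReal_ne_top,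
    ENNReal.toReal_ofReal hp.le, one_div]
  rfl

theorem mixedNorm_eq {X : Type*} [MeasurableSpace X] {μ : Measure X} {p q : ℝ}
    (hp : 0 < p) (g : ℤ → X → ℝ≥0∞) :
    mixedNorm μ p q g = (∑' k, (∫⁻ x, g k x ^ p ∂μ) ^ (q / p)) ^ q⁻¹ := by
  rw [mixedNorm, one_div]
  congr 2 with k
  rw [eLpNorm_ofReal_eq_lintegral hp, ← ENNReal.rpow_mul]
  congr 1
  ring

/-- With `S = ⨆ i, 2 ^ (i + 1) * a i`, a geometric series gives `∑ a i ≤ S`. The extra factors buy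
validity for every `t > 0`, and rapid convergence absorbs them. -/
theorem ENNReal.tsum_rpow_le_tsum (a : ℕ → ℝ≥0∞) {t : ℝ} (ht : 0 < t) :
    (∑' i, a i) ^ t ≤ ∑' i, (2 ^ (i + 1) * a i) ^ t := by
  refine le_trans ?_ (ENNReal.iSup_rpow_le_tsum _ ht)
  refine ENNReal.rpow_le_rpow ?_ ht.le
  set S := ⨆ i, 2 ^ (i + 1) * a i with hS
  calc ∑' i, a i ≤ ∑' i : ℕ, (2⁻¹ : ℝ≥0∞) ^ (i + 1) * S := by
        refine ENNReal.tsum_le_tsum fun i => ?_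
        have h : 2 ^ (i + 1) * a i ≤ S := le_iSup (fun i => 2 ^ (i + 1) * a i) i
        calc a i = (2⁻¹ : ℝ≥0∞) ^ (i + 1) * (2 ^ (i + 1) * a i) := by
              rw [← mul_assoc, ← mul_pow, ENNReal.inv_mul_cancel two_ne_zero ENNReal.ofNat_ne_top,
                one_pow, one_mul]
          _ ≤ _ := by gcongr
    _ = S := by
        rw [ENNReal.tsum_mul_right, ENNReal.tsum_geometric_add_one, ENNReal.one_sub_inv_two,
          inv_inv, ENNReal.inv_mul_cancel two_ne_zero ENNReal.ofNat_ne_top, one_mul]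

theorem tsum_lintegral_iSup_rpow_le {X : Type*} [MeasurableSpace X] {μ : Measure X}
    {G : ℕ → ℤ → X → ℝ≥0∞} (hG : ∀ i k, AEMeasurable (G i k) μ) {p t : ℝ} (hp : 0 < p)
    (ht : 0 < t) :
    ∑' k, (∫⁻ x, (⨆ i, G i k x) ^ p ∂μ) ^ t ≤
      ∑' i : ℕ, ∑' k, (2 ^ (i + 1) * ∫⁻ x, G i k x ^ p ∂μ) ^ t := by
  rw [ENNReal.tsum_comm]
  refine ENNReal.tsum_le_tsum fun k => ?_
  refine le_trans ?_ (ENNReal.tsum_rpow_le_tsum _ ht)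
  exact ENNReal.rpow_le_rpow (lintegral_iSup_rpow_le_tsum (fun i => hG i k) hp) ht.le

/-- An open set is its own neighbourhood, so `W` itself is a test function. Integrability makes `W`
finite almost everywhere; its infinity set joins the exceptional set. The one-sided hypothesis on
`W` becomes two-sided on exchanging `x` and `y`. -/
theorem besovCapacity_le {X : Type*} [MetricSpace X] [MeasurableSpace X] {μ : Measure X}
    {s p q : ℝ} (hp : 0 < p) {U : Set X} (hU : IsOpen U) {W : X → ℝ≥0∞} (hWm : Measurable W)
    (hWU : ∀ x ∈ U, 1 ≤ W x) {E : Set X} (hE : μ E = 0) {G : ℤ → X → ℝ≥0∞}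
    (hGm : ∀ k, AEMeasurable (G k) μ)
    (hG : ∀ (k : ℤ) (x y : X), x ∉ E → y ∉ E → (2 : ℝ) ^ (-k - 1) ≤ dist x y →
      dist x y < (2 : ℝ) ^ (-k) →
      W x ≤ W y + ENNReal.ofReal (dist x y ^ s) * (G k x + G k y))
    (hWint : ∫⁻ x, W x ^ p ∂μ ≠ ∞) (hGint : mixedNorm μ p q G ≠ ∞) :
    besovCapacity μ s p q U ≤ ((∫⁻ x, W x ^ p ∂μ) ^ p⁻¹ + mixedNorm μ p q G) ^ p := by
  have hWfin : ∀ᵐ x ∂μ, W x ≠ ∞ := by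
    filter_upwards [ae_lt_top' (hWm.pow_const p).aemeasurable hWint] with x hx hx'
    rw [hx', ENNReal.top_rpow_of_pos hp] at hx
    exact lt_irrefl _ hx
  have hgrad : IsFracGradient μ s (fun x => (W x : EReal)) G := by
    refine ⟨hGm, E ∪ {x | ¬ W x ≠ ∞}, measure_union_null hE (ae_iff.1 hWfin), ?_⟩
    intro k x y hx hy hk1 hk2
    rw [Set.mem_union, not_or, Set.mem_ofPred_eq, not_not] at hx hy
    refine EReal.abs_coe_ennreal_sub_le hx.2 hy.2 (hG k x y hx.1 hy.1 hk1 hk2) ?_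
    have := hG k y x hy.1 hx.1 (by rwa [dist_comm]) (by rwa [dist_comm])
    rwa [dist_comm, add_comm (G k y)] at this
  have hsemi : besovSeminorm μ s p q (fun x => (W x : EReal)) ≤ mixedNorm μ p q G :=
    iInf₂_le G hgrad
  have hnorm : eLpNorm (fun x => (W x : EReal).abs) (ENNReal.ofReal p) μ =
      (∫⁻ x, W x ^ p ∂μ) ^ p⁻¹ := by
    simp only [EReal.abs_coe_ennreal]
    exact eLpNorm_ofReal_eq_lintegral hp W
  have hadm : (fun x => (W x : EReal)) ∈ besovAdmissible μ s p q U := by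
    refine ⟨⟨⟨(measurable_coe_ennreal_ereal.comp hWm).aemeasurable, ?_⟩, ?_, ?_⟩,
      U, hU, subset_rfl, fun x hx => ?_⟩
    · filter_upwards [hWfin] with x hx
      exact ⟨by simpa using hx, EReal.coe_ennreal_ne_bot _⟩
    · rw [hnorm]
      exact ENNReal.rpow_lt_top_of_nonneg (inv_nonneg.2 hp.le) hWint
    · exact hsemi.trans_lt hGint.lt_top
    · have := EReal.coe_ennreal_le_coe_ennreal_iff.2 (hWU x hx)
      rwa [EReal.coe_ennreal_one] at this
  refine (iInf₂_le _ hadm).trans (ENNReal.rpow_le_rpow ?_ hp.le)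
  rw [besovNorm, hnorm]
  gcongr

/-! ### Rapid approximation and tail oscillation -/

/-- A sequence of continuous functions that approximates `f` rapidly in the Hajłasz–Besov norm. -/
theorem IsDoublingMeasure.exists_rapid_continuous_approx {X : Type*} [MetricSpace X]
    [MeasurableSpace X] [BorelSpace X] {μ : Measure X} (hμ : IsDoublingMeasure μ) {s p t : ℝ}
    (hs0 : 0 < s) (hs1 : s < 1) (hp : 0 < p) (ht : 0 < t)
    {f : X → ℝ} {g : ℤ → X → ℝ≥0∞} {E : Set X} (hE : μ E = 0)
    (hgm : ∀ k, AEMeasurable (g k) μ)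
    (hg : ∀ (k : ℤ) (x y : X), x ∉ E → y ∉ E → (2 : ℝ) ^ (-k - 1) ≤ dist x y →
      dist x y < (2 : ℝ) ^ (-k) →
      ENNReal.ofReal |f x - f y| ≤ ENNReal.ofReal (dist x y ^ s) * (g k x + g k y))
    (hsum : ∑' k, (∫⁻ x, g k x ^ p ∂μ) ^ t ≠ ∞) :
    ∃ (v : ℕ → X → ℝ) (D : ℕ → X → ℝ≥0∞) (G : ℕ → ℤ → X → ℝ≥0∞), (∀ i, Continuous (v i)) ∧
      (∀ i, AEMeasurable (D i) μ) ∧ (∀ i k, AEMeasurable (G i k) μ) ∧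
      (∀ i x, x ∉ E → 2 ^ i * ENNReal.ofReal |f x - v i x| ≤ D i x) ∧
      (∀ (i : ℕ) (k : ℤ) (x y : X), x ∉ E → y ∉ E → (2 : ℝ) ^ (-k - 1) ≤ dist x y →
        dist x y < (2 : ℝ) ^ (-k) →
        2 ^ i * ENNReal.ofReal |(f x - v i x) - (f y - v i y)| ≤
          ENNReal.ofReal (dist x y ^ s) * (G i k x + G i k y)) ∧
      (∀ i, ∫⁻ x, D i x ^ p ∂μ ≤ 2⁻¹ ^ i) ∧
      ∀ i, ∑' k, (2 ^ (i + 1) * ∫⁻ x, G i k x ^ p ∂μ) ^ t ≤ 2⁻¹ ^ i := by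
  have h2i : ∀ i : ℕ, (2 : ℝ≥0∞) ^ i ≠ ∞ := fun i => ENNReal.pow_ne_top ENNReal.ofNat_ne_top
  set P : ℕ → ℝ≥0∞ := fun i => (2 ^ i) ^ p with hP
  set Q : ℕ → ℝ≥0∞ := fun i => (2 ^ (i + 1) * P i) ^ t with hQ
  have hP' : ∀ i, P i ≠ ∞ := fun i => ENNReal.rpow_ne_top_of_nonneg hp.le (h2i i)
  have hQ' : ∀ i, Q i ≠ ∞ := fun i =>
    ENNReal.rpow_ne_top_of_nonneg ht.le (ENNReal.mul_ne_top (h2i _) (hP' i))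
  have hP0 : ∀ i, P i ≠ 0 := fun i =>
    (ENNReal.rpow_pos (pos_iff_ne_zero.2 (pow_ne_zero _ two_ne_zero)) (h2i i)).ne'
  -- `P i` and `Q i` are the factors that the weights put on the two quantities; dividing by their
  -- sum absorbs both with one tolerance.
  have hη : ∀ i, 0 < (P i + Q i)⁻¹ * (2⁻¹ : ℝ≥0∞) ^ i := fun i => by
    refine ENNReal.mul_pos (ENNReal.inv_ne_zero.2 (ENNReal.add_ne_top.2 ⟨hP' i, hQ' i⟩)) ?_
    exact pow_ne_zero _ (by simp)
  have hcancel : ∀ i, (P i + Q i) * ((P i + Q i)⁻¹ * (2⁻¹ : ℝ≥0∞) ^ i) = 2⁻¹ ^ i := fun i => by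
    rw [← mul_assoc, ENNReal.mul_inv_cancel (by simp [hP0]) (ENNReal.add_ne_top.2 ⟨hP' i, hQ' i⟩),
      one_mul]
  choose v D G hv hD hG hfv hgrad hDint hGint using fun i =>
    hμ.exists_continuous_approx_le hs0 hs1 hp ht hE hgm hg hsum (hη i)
  refine ⟨v, fun i x => 2 ^ i * D i x, fun i k x => 2 ^ i * G i k x, hv,
    fun i => (hD i).const_mul _, fun i k => (hG i k).const_mul _, ?_, ?_, ?_, ?_⟩
  · intro i x hx
    exact mul_le_mul_right (hfv i x hx) _
  · intro i k x y hx hy hk1 hk2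
    calc 2 ^ i * ENNReal.ofReal |(f x - v i x) - (f y - v i y)|
        ≤ 2 ^ i * (ENNReal.ofReal (dist x y ^ s) * (G i k x + G i k y)) := by
          gcongr
          exact hgrad i k x y hx hy hk1 hk2
      _ = _ := by ring
  · intro i
    rw [lintegral_const_mul_rpow _ (h2i i) hp, ← hcancel i]
    gcongr
    · exact le_self_add
    · exact hDint i
  · intro i
    calc ∑' k, (2 ^ (i + 1) * ∫⁻ x, (2 ^ i * G i k x) ^ p ∂μ) ^ t
        = Q i * ∑' k, (∫⁻ x, G i k x ^ p ∂μ) ^ t := by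
          rw [← ENNReal.tsum_mul_left]
          congr 1 with k
          rw [lintegral_const_mul_rpow _ (h2i i) hp, ← mul_assoc,
            ENNReal.mul_rpow_of_nonneg _ _ ht.le]
      _ ≤ (P i + Q i) * ((P i + Q i)⁻¹ * (2⁻¹ : ℝ≥0∞) ^ i) := by
          gcongr
          · exact le_add_self
          · exact hGint i
      _ = _ := hcancel i

/-- `⨆ i, 2 ^ (j + i) |v (j + i + 1) - v (j + i)|`, the tail oscillation of a sequence. -/
noncomputable def tailOscillation {X : Type*} (v : ℕ → X → ℝ) (j : ℕ) (x : X) : ℝ≥0∞ :=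
  ⨆ i : ℕ, 2 ^ (j + i) * ENNReal.ofReal |v (j + i + 1) x - v (j + i) x|

section TailOscillation

variable {X : Type*} {v : ℕ → X → ℝ}

theorem tailOscillation_le {D : ℕ → ℝ≥0∞} {f : X → ℝ} {x : X}
    (h : ∀ i, 2 ^ i * ENNReal.ofReal |f x - v i x| ≤ D i) (j : ℕ) :
    tailOscillation v j x ≤ 2 * ⨆ i, D (j + i) := by
  refine iSup_le fun i => ?_
  have h1 : D (j + i) ≤ ⨆ i, D (j + i) := le_iSup (fun i => D (j + i)) i
  have h2 : D (j + i + 1) ≤ ⨆ i, D (j + i) := le_iSup (fun i => D (j + i)) (i + 1)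
  calc 2 ^ (j + i) * ENNReal.ofReal |v (j + i + 1) x - v (j + i) x|
      ≤ 2 ^ (j + i) * (ENNReal.ofReal |f x - v (j + i) x| +
          ENNReal.ofReal |f x - v (j + i + 1) x|) := by
        rw [← ENNReal.ofReal_add (abs_nonneg _) (abs_nonneg _)]
        gcongr
        rw [show v (j + i + 1) x - v (j + i) x =
          (f x - v (j + i) x) - (f x - v (j + i + 1) x) by ring]
        exact abs_sub _ _
    _ ≤ 2 ^ (j + i) * ENNReal.ofReal |f x - v (j + i) x| +
          2 ^ (j + i + 1) * ENNReal.ofReal |f x - v (j + i + 1) x| := by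
        rw [mul_add]
        exact add_le_add le_rfl
          (mul_le_mul_left (pow_le_pow_right₀ one_le_two (Nat.le_succ _)) _)
    _ ≤ _ := by
        rw [two_mul]
        exact add_le_add ((h _).trans h1) ((h _).trans h2)

theorem tailOscillation_le_add {G : ℕ → ℝ≥0∞} {f : X → ℝ} {x y : X}
    (h : ∀ i, 2 ^ i * ENNReal.ofReal |(f x - v i x) - (f y - v i y)| ≤ G i) (j : ℕ) :
    tailOscillation v j x ≤ tailOscillation v j y + 2 * ⨆ i, G (j + i) := by
  refine iSup_le fun i => ?_
  -- The previous estimate applies to the differences between `x` and `y`, regarded as constant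
  -- functions.
  have h3 := tailOscillation_le (v := fun i _ => v i x - v i y) (f := fun _ => f x - f y) (x := x)
    (D := G) (fun i => by
      convert h i using 4
      ring) j
  have h4 : 2 ^ (j + i) * ENNReal.ofReal
      |(v (j + i + 1) x - v (j + i + 1) y) - (v (j + i) x - v (j + i) y)| ≤ 2 * ⨆ i, G (j + i) :=
    (le_iSup (fun i => 2 ^ (j + i) * ENNReal.ofReal
      |(v (j + i + 1) x - v (j + i + 1) y) - (v (j + i) x - v (j + i) y)|) i).trans h3
  have h5 : 2 ^ (j + i) * ENNReal.ofReal |v (j + i + 1) y - v (j + i) y| ≤ tailOscillation v j y :=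
    le_iSup (fun i => 2 ^ (j + i) * ENNReal.ofReal |v (j + i + 1) y - v (j + i) y|) i
  refine le_trans ?_ (add_le_add h5 h4)
  rw [← mul_add, ← ENNReal.ofReal_add (abs_nonneg _) (abs_nonneg _)]
  gcongr
  refine le_trans (le_of_eq ?_) (abs_add_le _ _)
  congr 1
  ring

theorem measurable_tailOscillation [TopologicalSpace X] [MeasurableSpace X] [BorelSpace X]
    (hv : ∀ i, Continuous (v i)) (j : ℕ) : Measurable (tailOscillation v j) :=
  Measurable.iSup fun _ =>
    (ENNReal.measurable_ofReal.comp ((hv _).sub (hv _)).abs.measurable).const_mul _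

/-- A supremum of continuous functions is lower semicontinuous, so its strict superlevel sets are
open. -/
theorem isOpen_one_lt_tailOscillation [TopologicalSpace X] (hv : ∀ i, Continuous (v i)) (j : ℕ) :
    IsOpen {x | 1 < tailOscillation v j x} := by
  simp only [tailOscillation, lt_iSup_iff]
  rw [Set.ofPred_exists]
  refine isOpen_iUnion fun i => isOpen_lt continuous_const ?_
  exact (ENNReal.continuous_const_mul (ENNReal.pow_ne_top ENNReal.ofNat_ne_top)).comp
    (ENNReal.continuous_ofReal.comp ((hv _).sub (hv _)).abs)

theorem abs_sub_le_of_tailOscillation_le_one {j : ℕ} {x : X} (h : tailOscillation v j x ≤ 1)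
    (i : ℕ) : dist (v (j + i) x) (v (j + (i + 1)) x) ≤ 2 / 2 / 2 ^ i := by
  have h1 : 2 ^ (j + i) * ENNReal.ofReal |v (j + i + 1) x - v (j + i) x| ≤ 1 :=
    (le_iSup (fun i => 2 ^ (j + i) * ENNReal.ofReal |v (j + i + 1) x - v (j + i) x|) i).trans h
  have h2 : ENNReal.ofReal (2 ^ (j + i) * |v (j + i + 1) x - v (j + i) x|) ≤ 1 := by
    rwa [ENNReal.ofReal_mul (by positivity), ENNReal.ofReal_pow two_pos.le, ENNReal.ofReal_ofNat]
  rw [ENNReal.ofReal_le_one] at h2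
  rw [dist_comm, Real.dist_eq, div_self two_ne_zero, le_div_iff₀ (by positivity), mul_comm]
  refine le_trans ?_ h2
  rw [← add_assoc]
  gcongr
  · exact one_le_two
  · omega

/-- On this set consecutive terms differ by at most `2 ^ (-i)` after the shift by `j`, so
convergence is uniform with rate `2 / 2 ^ n`. -/
theorem continuousOn_limUnder_of_tailOscillation_le_one [TopologicalSpace X]
    (hv : ∀ i, Continuous (v i)) (j : ℕ) :
    ContinuousOn (fun x => Filter.limUnder Filter.atTop fun i => v i x)
      {x | tailOscillation v j x ≤ 1} := by
  have hlim : ∀ x, tailOscillation v j x ≤ 1 →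
      Filter.Tendsto (fun i => v (j + i) x) Filter.atTop
        (nhds (Filter.limUnder Filter.atTop fun i => v i x)) := by
    intro x hx
    obtain ⟨a, ha⟩ := cauchySeq_tendsto_of_complete
      (cauchySeq_of_le_geometric_two (f := fun i => v (j + i) x)
        (abs_sub_le_of_tailOscillation_le_one hx))
    have ha' : Filter.Tendsto (fun i => v i x) Filter.atTop (nhds a) := by
      rw [← Filter.tendsto_add_atTop_iff_nat j]
      simpa only [add_comm] using ha
    rwa [ha'.limUnder_eq]
  have hunif : TendstoUniformlyOn (fun i x => v (j + i) x)
      (fun x => Filter.limUnder Filter.atTop fun i => v i x) Filter.atTop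
      {x | tailOscillation v j x ≤ 1} := by
    rw [Metric.tendstoUniformlyOn_iff]
    intro ε hε
    have h0 : Filter.Tendsto (fun n : ℕ => (2 : ℝ) / 2 ^ n) Filter.atTop (nhds 0) :=
      tendsto_const_nhds.div_atTop (tendsto_pow_atTop_atTop_of_one_lt one_lt_two)
    filter_upwards [h0.eventually_lt_const hε] with n hn x hx
    rw [dist_comm]
    exact (dist_le_of_le_geometric_two_of_tendsto (f := fun i => v (j + i) x)
      (abs_sub_le_of_tailOscillation_le_one hx) (hlim x hx) n).trans_lt hn
  exact hunif.continuousOn (Filter.Frequently.of_forall fun i => (hv (j + i)).continuousOn)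

end TailOscillation

/-! ### The quasicontinuous representative -/

theorem ENNReal.tendsto_tail_bound {p q : ℝ} (hp : 0 < p) (hq : 0 < q) {T : ℕ → ℝ≥0∞}
    (hT : Filter.Tendsto T Filter.atTop (nhds 0)) :
    Filter.Tendsto (fun j => (2 * T j ^ p⁻¹ + 2 * T j ^ q⁻¹) ^ p) Filter.atTop (nhds 0) := by
  have h : ∀ {a : ℝ}, 0 < a → Filter.Tendsto (fun j => 2 * T j ^ a⁻¹) Filter.atTop (nhds 0) := by
    intro a ha
    have := ENNReal.Tendsto.const_mul (a := 2) (hT.ennrpow_const a⁻¹) (Or.inr ENNReal.ofNat_ne_top)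
    rwa [ENNReal.zero_rpow_of_pos (inv_pos.2 ha), mul_zero] at this
  have := ((h hp).add (h hq)).ennrpow_const p
  rwa [add_zero, ENNReal.zero_rpow_of_pos hp] at this

theorem tendsto_of_forall_two_pow_mul_le {a : ℝ} {b : ℕ → ℝ} {M : ℝ≥0∞} (hM : M ≠ ∞)
    (h : ∀ i, 2 ^ i * ENNReal.ofReal |a - b i| ≤ M) : Filter.Tendsto b Filter.atTop (nhds a) := by
  rw [tendsto_iff_dist_tendsto_zero]
  have h0 : Filter.Tendsto (fun n : ℕ => M.toReal / 2 ^ n) Filter.atTop (nhds 0) :=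
    tendsto_const_nhds.div_atTop (tendsto_pow_atTop_atTop_of_one_lt one_lt_two)
  refine squeeze_zero (fun _ => dist_nonneg) (fun i => ?_) h0
  rw [le_div_iff₀ (by positivity), dist_comm, Real.dist_eq, mul_comm,
    ← ENNReal.ofReal_le_iff_le_toReal hM, ENNReal.ofReal_mul (by positivity),
    ENNReal.ofReal_pow two_pos.le, ENNReal.ofReal_ofNat]
  exact h i

theorem mainTheorem5 {X : Type*} [MetricSpace X] [MeasurableSpace X] [BorelSpace X]
    (μ : Measure X) (hμ : IsDoublingMeasure μ)
    (s p q : ℝ) (hs0 : 0 < s) (hs1 : s < 1) (hp : 0 < p) (hq : 0 < q)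
    (u : X → EReal) (hu : u ∈ besovSpace μ s p q) :
    ∃ v : X → EReal, BesovQuasicontinuous μ s p q v ∧ u =ᵐ[μ] v := by
  obtain ⟨⟨-, hfin⟩, -, hsemi⟩ := hu
  simp only [besovSeminorm, iInf_lt_iff] at hsemi
  obtain ⟨g, ⟨hgm, E₀, hE₀, hg₀⟩, hgfin⟩ := hsemi
  have ht : 0 < q / p := div_pos hq hp
  set f : X → ℝ := fun x => (u x).toReal with hf
  set E : Set X := E₀ ∪ {x | ¬ (u x ≠ ⊤ ∧ u x ≠ ⊥)} with hEdef
  have hE : μ E = 0 := measure_union_null hE₀ (ae_iff.1 hfin)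
  have hfu : ∀ x, x ∉ E → (f x : EReal) = u x := fun x hx => by
    rw [hEdef, Set.mem_union, not_or, Set.mem_ofPred_eq, not_not] at hx
    exact EReal.coe_toReal hx.2.1 hx.2.2
  have hg : ∀ (k : ℤ) (x y : X), x ∉ E → y ∉ E → (2 : ℝ) ^ (-k - 1) ≤ dist x y →
      dist x y < (2 : ℝ) ^ (-k) →
      ENNReal.ofReal |f x - f y| ≤ ENNReal.ofReal (dist x y ^ s) * (g k x + g k y) := by
    intro k x y hx hy hk1 hk2
    have := hg₀ k x y (fun h => hx (Or.inl h)) (fun h => hy (Or.inl h)) hk1 hk2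
    rwa [← hfu x hx, ← hfu y hy, ← EReal.coe_sub, EReal.abs_def] at this
  have hsum : ∑' k, (∫⁻ x, g k x ^ p ∂μ) ^ (q / p) ≠ ∞ := by
    rw [mixedNorm_eq hp, ENNReal.rpow_lt_top_iff_of_pos (inv_pos.2 hq)] at hgfin
    exact hgfin.ne
  obtain ⟨v, D, G, hv, hD, hG, hfv, hgrad, hDint, hGint⟩ :=
    hμ.exists_rapid_continuous_approx hs0 hs1 hp ht hE hgm hg hsum
  set T : ℕ → ℝ≥0∞ := fun j => ∑' i : ℕ, (2⁻¹ : ℝ≥0∞) ^ (i + j) with hT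
  have hgeo : ∑' i : ℕ, (2⁻¹ : ℝ≥0∞) ^ i ≠ ∞ := by
    rw [ENNReal.tsum_geometric, ENNReal.one_sub_inv_two, inv_inv]
    exact ENNReal.ofNat_ne_top
  have hT0 : Filter.Tendsto T Filter.atTop (nhds 0) := ENNReal.tendsto_sum_nat_add _ hgeo
  have hTfin : ∀ j, T j ≠ ∞ := fun j => ne_top_of_le_ne_top hgeo
    (ENNReal.tsum_comp_le_tsum_of_injective (add_left_injective j) fun i => (2⁻¹ : ℝ≥0∞) ^ i)
  have hSint : ∀ j, ∫⁻ x, (⨆ i, D (j + i) x) ^ p ∂μ ≤ T j := fun j =>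
    (lintegral_iSup_rpow_le_tsum (fun i => hD (j + i)) hp).trans
      (ENNReal.tsum_le_tsum fun i => by rw [add_comm i]; exact hDint _)
  have hΨint : ∀ j, ∑' k, (∫⁻ x, (⨆ i, G (j + i) k x) ^ p ∂μ) ^ (q / p) ≤ T j := fun j => by
    refine (tsum_lintegral_iSup_rpow_le (fun i k => hG (j + i) k) hp ht).trans
      (ENNReal.tsum_le_tsum fun i => ?_)
    rw [add_comm i j]
    refine le_trans (ENNReal.tsum_le_tsum fun k => ENNReal.rpow_le_rpow ?_ ht.le) (hGint (j + i))
    gcongr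
    · exact one_le_two
    · omega
  have h2p : ∀ a : ℝ≥0∞, (2 ^ p * a) ^ p⁻¹ = 2 * a ^ p⁻¹ := fun a => by
    rw [ENNReal.mul_rpow_of_nonneg _ _ (inv_nonneg.2 hp.le), ENNReal.rpow_rpow_inv hp.ne']
  have hWint : ∀ j, ∫⁻ x, tailOscillation v j x ^ p ∂μ ≤ 2 ^ p * T j := fun j => by
    calc ∫⁻ x, tailOscillation v j x ^ p ∂μ ≤ ∫⁻ x, (2 * ⨆ i, D (j + i) x) ^ p ∂μ := by
          refine lintegral_mono_ae ?_
          filter_upwards [measure_eq_zero_iff_ae_notMem.1 hE] with x hx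
          exact ENNReal.rpow_le_rpow (tailOscillation_le (fun i => hfv i x hx) j) hp.le
      _ = 2 ^ p * ∫⁻ x, (⨆ i, D (j + i) x) ^ p ∂μ :=
          lintegral_const_mul_rpow _ ENNReal.ofNat_ne_top hp
      _ ≤ _ := by gcongr; exact hSint j
  have hmixed : ∀ j, mixedNorm μ p q (fun k x => 2 * ⨆ i, G (j + i) k x) ≤ 2 * T j ^ q⁻¹ := by
    intro j
    have hterm : ∀ k, (∫⁻ x, (2 * ⨆ i, G (j + i) k x) ^ p ∂μ) ^ (q / p) =
        2 ^ q * (∫⁻ x, (⨆ i, G (j + i) k x) ^ p ∂μ) ^ (q / p) := fun k => by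
      rw [lintegral_const_mul_rpow _ ENNReal.ofNat_ne_top hp,
        ENNReal.mul_rpow_of_nonneg _ _ ht.le, ← ENNReal.rpow_mul, mul_div_cancel₀ _ hp.ne']
    rw [mixedNorm_eq hp]
    simp only [hterm]
    rw [ENNReal.tsum_mul_left, ENNReal.mul_rpow_of_nonneg _ _ (inv_nonneg.2 hq.le),
      ENNReal.rpow_rpow_inv hq.ne']
    gcongr
    exact hΨint j
  -- The test function is the tail oscillation, with fractional gradient `2 * ⨆ i, G (j + i) k`.
  have hcap : ∀ j, besovCapacity μ s p q {x | 1 < tailOscillation v j x} ≤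
      (2 * T j ^ p⁻¹ + 2 * T j ^ q⁻¹) ^ p := fun j => by
    refine (besovCapacity_le hp (isOpen_one_lt_tailOscillation hv j)
      (measurable_tailOscillation hv j) (fun x hx => le_of_lt hx) hE
      (G := fun k x => 2 * ⨆ i, G (j + i) k x)
      (fun k => (AEMeasurable.iSup fun i => hG (j + i) k).const_mul 2) ?_ ?_ ?_).trans ?_
    · intro k x y hx hy hk1 hk2
      refine (tailOscillation_le_add (fun i => hgrad i k x y hx hy hk1 hk2) j).trans ?_
      rw [← mul_add, mul_left_comm]
      refine add_le_add le_rfl (mul_le_mul_right (iSup_le fun i => ?_) _)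
      gcongr
      · exact le_iSup (fun i => G (j + i) k x) i
      · exact le_iSup (fun i => G (j + i) k y) i
    · exact ne_top_of_le_ne_top (ENNReal.mul_ne_top
        (ENNReal.rpow_ne_top_of_nonneg hp.le ENNReal.ofNat_ne_top) (hTfin j)) (hWint j)
    · exact ne_top_of_le_ne_top (ENNReal.mul_ne_top ENNReal.ofNat_ne_top
        (ENNReal.rpow_ne_top_of_nonneg (inv_nonneg.2 hq.le) (hTfin j))) (hmixed j)
    · gcongr
      · rw [← h2p]
        gcongr
        exact hWint j
      · exact hmixed j
  -- Where `v i x` diverges, `limUnder` has an arbitrary value; such points lie in every set `{x | 1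
  -- < tailOscillation v j x}`.
  refine ⟨fun x => ((Filter.limUnder Filter.atTop fun i => v i x : ℝ) : EReal), ?_, ?_⟩
  · intro ε hε
    obtain ⟨j, hj⟩ := ((ENNReal.tendsto_tail_bound hp hq hT0).eventually_lt_const
      (ENNReal.ofReal_pos.2 hε)).exists
    refine ⟨{x | 1 < tailOscillation v j x}, (hcap j).trans_lt hj, ?_⟩
    refine continuous_coe_real_ereal.comp_continuousOn
      ((continuousOn_limUnder_of_tailOscillation_le_one hv j).mono fun x hx => ?_)
    rwa [Set.mem_compl_iff, Set.mem_ofPred_eq, not_lt] at hx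
  -- Finiteness of this supremum bounds `2 ^ i * |f x - v i x|` in `i`, which forces `v i x → f x`.
  · have hS0 : ∀ᵐ x ∂μ, (⨆ i, D (0 + i) x) ^ p < ∞ :=
      ae_lt_top' ((AEMeasurable.iSup fun i => hD (0 + i)).pow_const p)
        (ne_top_of_le_ne_top (hTfin 0) (hSint 0))
    filter_upwards [hS0, measure_eq_zero_iff_ae_notMem.1 hE] with x hx hxE
    have hlim : Filter.Tendsto (fun i => v i x) Filter.atTop (nhds (f x)) := by
      refine tendsto_of_forall_two_pow_mul_le ((ENNReal.rpow_lt_top_iff_of_pos hp).1 hx).ne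
        fun i => (hfv i x hxE).trans ?_
      have := le_iSup (fun i => D (0 + i) x) i
      simpa only [zero_add] using this
    rw [hlim.limUnder_eq, hfu x hxE]
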